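/- Let $\eta(z)=q^{1/24}\prod_{n\ge1}(1-q^n)$, $q=e^{2\pi i z}$, be Dedekind's function on the upper half-plane $\mathbb H$, and write $\zeta_n^x=e^{2\pi i x/n}$ for $x\in\mathbb Q$. Let $p_1,p_2$ be primes, $N=p_1p_2$, $r=(p_1-1)(p_2-1)/24$, $s=24/\gcd(24,(p_1-1)(p_2-1))$, $\phi=\zeta_{24}^{24r}=\zeta_{24}^{(p_1-1)(p_2-1)}$, and $$\mathfrak w_{p_1,p_2}(z)=\frac{\eta(z/p_1)\,\eta(z/p_2)}{\eta(z/(p_1p_2))\,\eta(z)} .$$ Let $\Gamma^0(N)\subset \mathrm{SL}_2(\mathbb Z)$ be the subgroup of matrices whose upper right entry is divisible by $N$, $T=\begin{pmatrix}1&1\\0&1\end{pmatrix}$, $S=\begin{pmatrix}0&-1\\1&0\end{pmatrix}$, and $(f\circ M)(z)=f(Mz)$. A function $f$ on $\mathbb H$ is said to have order $\mathrm{ord}\in\mathbb Q$ and leading coefficient $l\ne0$ if for some integer $m\geq 1$ it has a convergent expansion $f(z)=\sum_{n\ge0}a_n e^{2\pi i z(\mathrm{ord}+n/m)}$ on $\mathbb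 H$ with $a_0=l$. The function $\mathfrak w_{p_1,p_2}^s$ is invariant under $\Gamma^0(N)$, and the conjugates $\mathfrak w_{p_1,p_2}\circ M$, for $M$ in a complete system of representatives of $\Gamma^0(N)\backslash \mathrm{SL}_2(\mathbb Z)$, are as follows. 1. In all cases there are the following $N+1$ conjugates. - For $0\le\nu<N$, $\mathfrak w_{p_1,p_2}\circ T^\nu=A_\nu$, where $$A_\nu(z)=\frac{\eta\left(\frac{z+\nu}{p_1}\right)\eta\left(\frac{z+\nu}{p_2}\right)}{\eta(z+\nu)\,\eta\left(\frac{z+\nu}{p_1p_2}\right)}=\mathfrak w_{p_1,p_2}(z+\nu),$$ of order $-r/N$ and leading coefficient $\zeta_N^{-\nu r}$. - $\mathfrak w_{p_1,p_2}\circ S=B$, where $$B(z)=\frac{\eta(p_1z)\,\eta(p_2z)}{\eta(z)\,\eta(p_1p_2z)}=\mathfrak w_{p_1,p_2}(Nz),$$ of order $-r$ and leading coefficient $1$. 2. Suppose $p_1\ne p_2$, and let $u,v$ be any integers with $up_1+vp_2=1$. There are $p_1+p_2$ further conjugates $C_{2,\nu}$ ($0\le\nu<p_2$) and $C_{1,\nu}$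 ($0\le\nu<p_1$). - Put $M_{2,0}=\begin{pmatrix}up_1&-vp_2\\1&1\end{pmatrix}$ and $M_{2,\mu}=\begin{pmatrix}\mu p_1&-1\\1&0\end{pmatrix}$ for $1\le\mu<p_2$. For $1\le\mu<p_2$ let $1\le\nu<p_2$ be determined by $\nu\equiv-(\mu p_1)^{-1}\bmod p_2$ (every such $\nu$ arises from exactly one $\mu$), and $v_2=(1+p_1\mu\nu)/p_2$; $\mu=0$ corresponds to $\nu=0$. Then $\mathfrak w_{p_1,p_2}\circ M_{2,\mu}=C_{2,\nu}$, where $$C_{2,\nu}(z)=\phi^{\theta_2(\nu)}\varepsilon_2\,\frac{\eta(p_1(z+\nu))\,\eta\left(\frac{z+\nu}{p_2}\right)}{\eta(z+\nu)\,\eta\left(\frac{p_1(z+\nu)}{p_2}\right)},$$ of order $r/p_2$ and leading coefficient $\phi^{\theta_2(\nu)}\varepsilon_2\zeta_{p_2}^{\nu r}$. Here, if $p_2\ne2$, $\varepsilon_2=\left(\frac{p_1}{p_2}\right)$ (Legendre symbol), $\theta_2(\nu)=\mu((p_2+1)v_2+1)+\nu$ for $\nu>0$, and $\theta_2(0)=uv(p_2+1)+u-1$.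 If $p_2=2$, $\varepsilon_2=1$, $\theta_2(\nu)=(3p_1+2)\frac{\nu+1}2$ for $\nu>0$, and $\theta_2(0)=\frac{(3u+2)(u-1)}2$. - The matrices $M_{1,\mu}$, the functions $C_{1,\nu}$ and the data $\theta_1,\varepsilon_1$ are obtained by exchanging $(p_1,u)$ and $(p_2,v)$: $M_{1,0}=\begin{pmatrix}vp_2&-up_1\\1&1\end{pmatrix}$, $M_{1,\mu}=\begin{pmatrix}\mu p_2&-1\\1&0\end{pmatrix}$ for $1\le\mu<p_1$, and $\mathfrak w_{p_1,p_2}\circ M_{1,\mu}=C_{1,\nu}$, where $\nu\equiv-(\mu p_2)^{-1}\bmod p_1$, $1\le\nu<p_1$, for $\mu\ne0$, $\nu=0$ for $\mu=0$, and $$C_{1,\nu}(z)=\phi^{\theta_1(\nu)}\varepsilon_1\,\frac{\eta\left(\frac{z+\nu}{p_1}\right)\eta(p_2(z+\nu))}{\eta(z+\nu)\,\eta\left(\frac{p_2(z+\nu)}{p_1}\right)},$$ of order $r/p_1$ and leading coefficient $\phi^{\theta_1(\nu)}\varepsilon_1\zeta_{p_1}^{\nu r}$. The $(N+1)+(p_1+p_2)$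 matrices $T^\nu$, $S$, $M_{1,\mu}$, $M_{2,\mu}$ are distinct and form a complete system of representatives of $\Gamma^0(N)\backslash\mathrm{SL}_2(\mathbb Z)$. 3. Suppose $p_1=p_2=p$. There are $p-1$ further conjugates. For $1\le\mu<p$ put $M_\mu=\begin{pmatrix}\mu p&-1\\1&0\end{pmatrix}$, and let $1\le\nu<p$ and $v\in\mathbb Z$ be determined by $1=-\mu\nu+vp$ (every such $\nu$ arises from exactly one $\mu$). Then $\mathfrak w_{p,p}\circ M_\mu=C_\nu$, where $$C_\nu(z)=\sqrt p\,\varepsilon(\nu)\,\zeta_{24}^{\theta(\nu)}\,\frac{\eta(pz)^2}{\eta(z)\,\eta\left(z+\frac\nu p\right)},$$ of order $\frac{p-1}{12}$ and leading coefficient $\sqrt p\,\varepsilon(\nu)\,\zeta_{24p}^{p\theta(\nu)-\nu}$. Here, if $p$ is odd, $\varepsilon(\nu)=\left(\frac{-\nu}p\right)$ and $\theta(\nu)=p\nu(1-\mu^2)+(-3p+2+v)\mu-3+3p$; if $p=2$, $\varepsilon(\nu)=1$ and $\theta(\nu)=0$. The $(N+1)+(p-1)$ matrices $T^\nu$, $S$,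 $M_\mu$ are distinct and form a complete system of representatives of $\Gamma^0(N)\backslash\mathrm{SL}_2(\mathbb Z)$. -/

import Mathlib

open scoped UpperHalfPlane MatrixGroups

noncomputable section

namespace DoubleEta

/-- The subgroup `Γ⁰(N)` of `SL(2, ℤ)`: upper right entry divisible by `N`. -/
def GammaUpper0 (N : ℕ) : Subgroup SL(2, ℤ) where
  carrier := {g | (N : ℤ) ∣ g 0 1}
  one_mem' := by simp
  mul_mem' := by
    intro a b ha hb
    change (N : ℤ) ∣ a 0 1 at ha
    change (N : ℤ) ∣ b 0 1 at hb
    change (N : ℤ) ∣ (a * b) 0 1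
    simp only [Matrix.SpecialLinearGroup.coe_mul, Matrix.mul_apply,
      Fin.sum_univ_two]
    exact dvd_add (hb.mul_left _) (ha.mul_right _)
  inv_mem' := by
    intro a ha
    change (N : ℤ) ∣ a 0 1 at ha
    change (N : ℤ) ∣ (a⁻¹) 0 1
    rw [Matrix.SpecialLinearGroup.SL2_inv_expl]
    simpa using ha

/-- `ζ_n ^ x = exp (2πi x / n)` for a rational exponent `x`. -/
def zetaPow (n : ℕ) (x : ℚ) : ℂ :=
  Complex.exp (2 * Real.pi * Complex.I * (x : ℂ) / (n : ℂ))

/-- The rational number `r = (p₁ - 1)(p₂ - 1) / 24`. -/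
def r (p₁ p₂ : ℕ) : ℚ := ((p₁ : ℚ) - 1) * ((p₂ : ℚ) - 1) / 24

/-- The exponent `s = 24 / gcd (24, (p₁ - 1)(p₂ - 1))` (the division is exact). -/
def s (p₁ p₂ : ℕ) : ℕ := 24 / Nat.gcd 24 ((p₁ - 1) * (p₂ - 1))

/-- `φ = ζ₂₄ ^ (24 r) = ζ₂₄ ^ ((p₁ - 1)(p₂ - 1))`. -/
def phi (p₁ p₂ : ℕ) : ℂ := zetaPow 24 (24 * r p₁ p₂)

/-- The double `η`-quotient `𝔴_{p₁,p₂}(z) = η(z/p₁) η(z/p₂) / (η(z/(p₁p₂)) η(z))`. -/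
def w (p₁ p₂ : ℕ) (z : ℂ) : ℂ :=
  ModularForm.eta (z / p₁) * ModularForm.eta (z / p₂) /
    (ModularForm.eta (z / (p₁ * p₂)) * ModularForm.eta z)

/-- The function `f` on the upper half-plane has a (convergent) Puiseux expansion
`f = ∑ₙ aₙ q^(ord + n/m)`, `q^x = exp (2πi x z)`, with nonzero leading coefficient `a₀ = l`. -/
def HasQLeadingTerm (f : ℂ → ℂ) (ord : ℚ) (l : ℂ) : Prop :=
  l ≠ 0 ∧ ∃ (m : ℕ) (a : ℕ → ℂ), 0 < m ∧ a 0 = l ∧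
    ∀ z : ℂ, 0 < z.im →
      HasSum (fun n : ℕ => a n * Complex.exp
        (2 * Real.pi * Complex.I * ((ord : ℂ) + (n : ℂ) / (m : ℂ)) * z)) (f z)

/-- `𝔴_{p₁,p₂} ∘ M = f` on the upper half-plane, and `f` has `q`-order `ord` and leading
coefficient `l`. -/
def IsConjugate (p₁ p₂ : ℕ) (M : SL(2, ℤ)) (f : ℂ → ℂ) (ord : ℚ) (l : ℂ) : Prop :=
  (∀ z : ℍ, w p₁ p₂ ((M • z : ℍ) : ℂ) = f (z : ℂ)) ∧ HasQLeadingTerm f ord l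

/-- `A_ν`. -/
def A (p₁ p₂ ν : ℕ) (z : ℂ) : ℂ :=
  ModularForm.eta ((z + ν) / p₁) * ModularForm.eta ((z + ν) / p₂) /
    (ModularForm.eta (z + ν) * ModularForm.eta ((z + ν) / (p₁ * p₂)))

/-- `B`. -/
def B (p₁ p₂ : ℕ) (z : ℂ) : ℂ :=
  ModularForm.eta (p₁ * z) * ModularForm.eta (p₂ * z) /
    (ModularForm.eta z * ModularForm.eta (p₁ * p₂ * z))

/-- The matrix `(μ p, -1; 1, 0)`. -/
def M (p : ℕ) (μ : ℤ) : SL(2, ℤ) :=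
  ⟨!![μ * p, -1; 1, 0], by simp [Matrix.det_fin_two]⟩

/-- The matrix `M_{2,0} = (u p₁, -v p₂; 1, 1)`, where `u p₁ + v p₂ = 1`. Exchanging the roles of
`(p₁, u)` and `(p₂, v)` gives `M_{1,0}`. -/
def M0 (p₁ p₂ : ℕ) (u v : ℤ) (h : u * p₁ + v * p₂ = 1) : SL(2, ℤ) :=
  ⟨!![u * p₁, -(v * p₂); 1, 1], by
    simp only [Matrix.det_fin_two_of]
    linarith⟩

/-! The functions `C_{2,ν}` and their data. Everything for `C_{1,ν}` is obtained by exchanging the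
roles of `(p₁, u)` and `(p₂, v)`. -/

/-- `θ₂(ν)` for `0 < ν < p₂`, where `ν ≡ -(μ p₁)⁻¹ mod p₂` and `v₂ = (1 + p₁ μ ν) / p₂`. In the
case `p₂ = 2` one has `ν = 1`, so that the division is exact. -/
def theta (p₁ p₂ : ℕ) (μ ν v₂ : ℤ) : ℤ :=
  if p₂ = 2 then (3 * p₁ + 2) * ((ν + 1) / 2) else μ * ((p₂ + 1) * v₂ + 1) + ν

/-- `θ₂(0)`, where `u p₁ + v p₂ = 1`. In the case `p₂ = 2` the integer `u` is odd, so that the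
division is exact. -/
def theta0 (p₂ : ℕ) (u v : ℤ) : ℤ :=
  if p₂ = 2 then (3 * u + 2) * (u - 1) / 2 else u * v * (p₂ + 1) + u - 1

/-- `ε₂`. -/
def eps (p₁ p₂ : ℕ) [Fact p₂.Prime] : ℤ :=
  if p₂ = 2 then 1 else legendreSym p₂ p₁

/-- The constant factor `φ ^ θ · ε₂` of `C_{2,ν}`, for `θ = θ₂(ν)`. -/
def factor (p₁ p₂ : ℕ) [Fact p₂.Prime] (θ : ℤ) : ℂ :=
  phi p₁ p₂ ^ θ * (eps p₁ p₂ : ℂ)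

/-- `C_{2,ν}`, for `θ = θ₂(ν)`. -/
def C (p₁ p₂ : ℕ) [Fact p₂.Prime] (θ : ℤ) (ν : ℕ) (z : ℂ) : ℂ :=
  factor p₁ p₂ θ *
    (ModularForm.eta (p₁ * (z + ν)) * ModularForm.eta ((z + ν) / p₂) /
      (ModularForm.eta (z + ν) * ModularForm.eta (p₁ * (z + ν) / p₂)))

/-! The case `p₁ = p₂ = p`. -/

/-- `θ(ν)`, where `1 = -μ ν + v p`. -/
def thetaSq (p : ℕ) (μ ν v : ℤ) : ℤ :=
  if p = 2 then 0 else p * ν * (1 - μ ^ 2) + (-3 * p + 2 + v) * μ - 3 + 3 * p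

/-- `ε(ν)`. -/
def epsSq (p : ℕ) [Fact p.Prime] (ν : ℤ) : ℤ :=
  if p = 2 then 1 else legendreSym p (-ν)

/-- `C_ν`, for `θ = θ(ν)`. -/
def CSq (p : ℕ) [Fact p.Prime] (θ : ℤ) (ν : ℕ) (z : ℂ) : ℂ :=
  (Real.sqrt p : ℂ) * (epsSq p ν : ℂ) * zetaPow 24 θ *
    (ModularForm.eta (p * z) ^ 2 / (ModularForm.eta z * ModularForm.eta (z + ν / p)))

/-! The lists of matrices. -/

/-- The matrices `T^ν` (`0 ≤ ν < N`) and `S`. -/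
def commonReps (N : ℕ) : Set SL(2, ℤ) :=
  {g | ∃ ν : ℕ, ν < N ∧ g = ModularGroup.T ^ ν} ∪ {ModularGroup.S}

/-- The matrices `M_{2,0}` and `M_{2,μ}` (`1 ≤ μ < p₂`). -/
def mixedReps (p₁ p₂ : ℕ) (u v : ℤ) (h : u * p₁ + v * p₂ = 1) : Set SL(2, ℤ) :=
  {M0 p₁ p₂ u v h} ∪ {g | ∃ μ : ℕ, 1 ≤ μ ∧ μ < p₂ ∧ g = M p₁ μ}

/-- The matrices `M_μ` (`1 ≤ μ < p`). -/
def squareReps (p : ℕ) : Set SL(2, ℤ) :=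
  {g | ∃ μ : ℕ, 1 ≤ μ ∧ μ < p ∧ g = M p μ}

/-- `R` is a complete system of representatives of the cosets `Γ⁰(N) γ` in `SL(2, ℤ)`. -/
def IsCosetSystem (N : ℕ) (R : Set SL(2, ℤ)) : Prop :=
  Subgroup.IsComplement (GammaUpper0 N : Set SL(2, ℤ)) R

end DoubleEta

end

noncomputable section

namespace DoubleEta

open ModularForm
open Complex hiding eta
open scoped NumberTheorySymbols

/-! Everything rests on an explicit multiplier for `η`. For a matrix of determinant 1 with odd
positive lower left entry `c`, the factor relating `η(gz)` to `η(z)` is a Jacobi symbol `J(d | c)`,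
a 24th root of unity whose exponent is polynomial in the entries, and the principal square root of
`-i(cz+d)` (`etaTransform_of_odd`). This is proved by Euclidean descent on `c`. A translation of `z`
makes the lower right entry odd and smaller than `c` in absolute value, the inversion `z ↦ -1/z`
exchanges the roles of `c` and `d`, and quadratic reciprocity turns `J(c | d)` back into `J(d | c)`.
The same exchange gives the formula for odd `d > 0` (`eta_of_odd_right`), which serves when `c` is
even.

For `x = Mz`, each of `x`, `x/p₁`, `x/p₂`, `x/(p₁p₂)` is the image, under a determinant-one matrix,
of the argument occurring in the conjugate, up to integer translations. The weight factors cancel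
between numerator and denominator, leaving `√p` when `p₁ = p₂ = p`. What remains is a product of
Jacobi symbols and a congruence modulo 24, checked separately modulo 3 and modulo 8. For `Γ⁰(N)` the
remaining exponent is a multiple of `(p₁-1)(p₂-1)`, hence killed by the power `s`.

Orders and leading coefficients follow from the product for `η`: an `η`-quotient is a power of `q`
times a zero-free holomorphic function of a root of `q` on the unit disc.

The coset of `g` depends only on its top row as a point `(a : b)` of the projective line over `ℤ/N`.
The families of representatives are separated by which prime factors of `N` divide `a`; for `N = p²`
and `p ∣ a`, by whether `p² ∣ a`. -/

/-! ### Calculus of 24th roots of unity. -/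

/-- `exp (2πi k / 24)`. -/
def e24 (k : ℤ) : ℂ := Complex.exp (2 * Real.pi * Complex.I * k / 24)

lemma e24_add (k l : ℤ) : e24 (k + l) = e24 k * e24 l := by
  rw [e24, e24, e24, ← Complex.exp_add]
  congr 1
  push_cast
  ring

lemma e24_zero : e24 0 = 1 := by simp [e24]

lemma e24_ne_zero (k : ℤ) : e24 k ≠ 0 := Complex.exp_ne_zero _

lemma e24_neg (k : ℤ) : e24 (-k) = (e24 k)⁻¹ := by
  rw [e24, e24, ← Complex.exp_neg]
  congr 1
  push_cast
  ring

lemma e24_sub (k l : ℤ) : e24 (k - l) = e24 k / e24 l := by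
  rw [sub_eq_add_neg, e24_add, e24_neg, div_eq_mul_inv]

lemma e24_mul (k l : ℤ) : e24 (k * l) = e24 k ^ l := by
  rw [e24, e24, ← Complex.exp_int_mul]
  congr 1
  push_cast
  ring

lemma e24_pow (k : ℤ) (n : ℕ) : e24 k ^ n = e24 (n * k) := by
  rw [mul_comm, e24_mul, zpow_natCast]

lemma e24_mul_24 (k : ℤ) : e24 (24 * k) = 1 := by
  rw [e24, Complex.exp_eq_one_iff]
  refine ⟨k, ?_⟩
  push_cast
  ring

lemma e24_congr {k l : ℤ} (h : (24 : ℤ) ∣ k - l) : e24 k = e24 l := by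
  obtain ⟨m, hm⟩ := h
  rw [show k = 24 * m + l by linarith, e24_add, e24_mul_24, one_mul]

lemma dvd_24_of {x : ℤ} (h3 : (3 : ℤ) ∣ x) (h8 : (8 : ℤ) ∣ x) : (24 : ℤ) ∣ x := by omega

lemma e24_12 : e24 12 = -1 := by
  rw [e24, ← Complex.exp_pi_mul_I]
  congr 1
  push_cast
  ring

lemma e24_12_mul (k : ℕ) : e24 (12 * k) = (-1) ^ k := by
  rw [e24_mul, e24_12, zpow_natCast]

lemma zetaPow_24 (k : ℤ) : zetaPow 24 k = e24 k := by
  simp [zetaPow, e24]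

lemma phi_zpow (p₁ p₂ : ℕ) (θ : ℤ) :
    phi p₁ p₂ ^ θ = e24 (((p₁ : ℤ) - 1) * ((p₂ : ℤ) - 1) * θ) := by
  rw [phi, show 24 * r p₁ p₂ = ((((p₁ : ℤ) - 1) * ((p₂ : ℤ) - 1) : ℤ) : ℚ) by
    rw [r]; push_cast; ring, zetaPow_24, e24_mul _ θ]

/-! The Dedekind function under translations and inversion. -/

lemma eta_add_int (z : ℂ) (k : ℤ) : eta (z + k) = e24 k * eta z := by
  have h1 : ∀ n, eta_q n (z + k) = eta_q n z := by
    intro n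
    rw [eta_q, eta_q, Function.Periodic.qParam, Function.Periodic.qParam]
    congr 1
    rw [Complex.exp_eq_exp_iff_exists_int]
    exact ⟨k, by push_cast; ring⟩
  rw [eta, eta, ← mul_assoc]
  simp_rw [h1]
  congr 1
  rw [Function.Periodic.qParam, Function.Periodic.qParam, e24, ← Complex.exp_add]
  congr 1
  push_cast
  ring

lemma sqrt_mul_of_arg {x y : ℂ} (hx : x ≠ 0) (hy : y ≠ 0)
    (h : x.arg + y.arg ∈ Set.Ioc (-Real.pi) Real.pi) : (x * y).sqrt = x.sqrt * y.sqrt := by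
  rw [sqrt_eq_exp hx, sqrt_eq_exp hy, sqrt_eq_exp (mul_ne_zero hx hy), ← Complex.exp_add,
    Complex.log_mul_eq_add_log_iff hx hy |>.2 h]
  ring_nf

/-- In the right half-plane both arguments are below `π/2` in absolute value, so their sum does not
cross the branch cut. This is why automorphy factors are written with `-I * (cz + d)`, whose real
part is `c * im z`. -/
lemma sqrt_mul_of_re_pos {x y : ℂ} (hx : 0 < x.re) (hy : 0 < y.re) :
    (x * y).sqrt = x.sqrt * y.sqrt := by
  refine sqrt_mul_of_arg (by rintro rfl; simp at hx) (by rintro rfl; simp at hy) ?_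
  have h1 := abs_lt.1 (Complex.abs_arg_lt_pi_div_two_iff.2 (Or.inl hx))
  have h2 := abs_lt.1 (Complex.abs_arg_lt_pi_div_two_iff.2 (Or.inl hy))
  constructor <;> linarith [h1.1, h1.2, h2.1, h2.2]

lemma sqrt_I : Complex.sqrt I = e24 3 := by
  rw [sqrt_eq_exp I_ne_zero, Complex.log_I, e24]
  congr 1
  push_cast
  ring

lemma sqrt_neg_I : Complex.sqrt (-I) = e24 (-3) := by
  rw [sqrt_eq_exp (neg_ne_zero.2 I_ne_zero), Complex.log_neg_I, e24]
  congr 1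
  push_cast
  ring

lemma sqrt_I_mul {x : ℂ} (hx : 0 < x.re) : (I * x).sqrt = e24 3 * x.sqrt := by
  rw [← sqrt_I]
  refine sqrt_mul_of_arg I_ne_zero (by rintro rfl; simp at hx) ?_
  have h1 := abs_lt.1 (Complex.abs_arg_lt_pi_div_two_iff.2 (Or.inl hx))
  rw [Complex.arg_I]
  constructor <;> linarith [h1.1, h1.2, Real.pi_pos]

lemma sqrt_neg_I_mul {x : ℂ} (hx : 0 < x.re) : (-I * x).sqrt = e24 (-3) * x.sqrt := by
  rw [← sqrt_neg_I]
  refine sqrt_mul_of_arg (neg_ne_zero.2 I_ne_zero) (by rintro rfl; simp at hx) ?_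
  have h1 := abs_lt.1 (Complex.abs_arg_lt_pi_div_two_iff.2 (Or.inl hx))
  rw [Complex.arg_neg_I]
  constructor <;> linarith [h1.1, h1.2, Real.pi_pos]

lemma sqrt_ne_zero {x : ℂ} (hx : x ≠ 0) : x.sqrt ≠ 0 := by
  rw [sqrt_eq_exp hx]
  exact Complex.exp_ne_zero _

lemma neg_one_div_im_pos {z : ℂ} (hz : 0 < z.im) : 0 < (-1 / z).im := by
  have h := UpperHalfPlane.im_inv_neg_coe_pos ⟨z, hz⟩
  simpa [neg_div, inv_neg] using h

lemma ne_zero_of_im_pos {z : ℂ} (hz : 0 < z.im) : z ≠ 0 := by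
  rintro rfl
  simp at hz

lemma eta_neg_one_div {z : ℂ} (hz : 0 < z.im) :
    eta (-1 / z) = (-I * z).sqrt * eta z := by
  have h := eta_comp_eq_csqrt_I_inv hz
  simp only [Function.comp_apply, Pi.smul_apply, Pi.mul_apply, smul_eq_mul] at h
  have hre : 0 < (-I * z).re := by simpa using hz
  have h2 : z.sqrt = Complex.sqrt I * (-I * z).sqrt := by
    rw [sqrt_I, ← sqrt_I_mul hre]
    congr 1
    rw [← mul_assoc]
    simp
  rw [h, h2, ← mul_assoc, inv_mul_cancel_left₀ (sqrt_ne_zero I_ne_zero)]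

/-! The multiplier of the Dedekind function. -/

/-- The transformation formula of `η` for all matrices with lower left entry `c`. -/
def EtaTransform (c : ℕ) : Prop :=
  ∀ a b d : ℤ, a * d - b * c = 1 → ∀ z : ℂ, 0 < z.im →
    eta ((a * z + b) / (c * z + d)) =
      (J(d | c) : ℂ) * e24 ((a + d) * c - b * d * (c ^ 2 - 1) - 3 * c + 3) *
        (-I * (c * z + d)).sqrt * eta z

lemma denom_ne_zero {a b c d : ℤ} (h : a * d - b * c = 1) {z : ℂ} (hz : 0 < z.im) :
    (c * z + d : ℂ) ≠ 0 := by
  intro h0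
  have him := congrArg Complex.im h0
  have hre := congrArg Complex.re h0
  simp only [add_im, mul_im, intCast_re, intCast_im, zero_mul, add_zero, zero_im,
    mul_eq_zero, Int.cast_eq_zero, add_re, mul_re, sub_zero, zero_re] at him hre
  rcases him with hc | h'
  · subst hc
    have hd : d = 0 := by simpa using hre
    subst hd
    simp at h
  · exact hz.ne' h'

/-- Factor the matrix as `(b, -a; d, -c)` times `S`: the entry `d` moves to the lower left, where
the known formula applies at `-1/z`. The two square roots combine because both radicands lie in the
right half-plane. -/
lemma eta_of_odd_right {d : ℕ} (hd0 : 0 < d) (hE : EtaTransform d) {a b c : ℤ}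
    (hdet : a * d - b * c = 1) {z : ℂ} (hz : 0 < z.im) :
    eta ((a * z + b) / (c * z + d)) =
      (J(-c | d) : ℂ) * e24 ((b - c) * d - a * c * (d ^ 2 - 1) - 3 * d + 3) *
        (c * z + d : ℂ).sqrt * eta z := by
  have hz0 := ne_zero_of_im_pos hz
  have hden : (c * z + d : ℂ) ≠ 0 := by
    simpa using denom_ne_zero (a := a) (b := b) (c := c) (d := (d : ℤ)) hdet hz
  have hz' := neg_one_div_im_pos hz
  have h := hE b (-a) (-c) (by linarith) (-1 / z) hz'
  have h1 : ((b : ℂ) * (-1 / z) + ((-a : ℤ) : ℂ)) / (d * (-1 / z) + ((-c : ℤ) : ℂ)) =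
      (a * z + b) / (c * z + d) := by
    have h3 : (d : ℂ) * (-1 / z) + ((-c : ℤ) : ℂ) = -(c * z + d) / z := by
      push_cast
      field_simp
      ring
    rw [h3]
    push_cast
    field_simp
    ring
  rw [h1, eta_neg_one_div hz] at h
  have hs : (c * z + d : ℂ).sqrt =
      (-I * (d * (-1 / z) + ((-c : ℤ) : ℂ))).sqrt * (-I * z).sqrt := by
    rw [← sqrt_mul_of_re_pos]
    · congr 1
      push_cast
      field_simp
      rw [I_sq]
      ring
    · have h4 : (-I * (d * (-1 / z) + ((-c : ℤ) : ℂ))).re = d * (-1 / z).im := by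
        simp
      rw [h4]
      positivity
    · simpa using hz
  rw [h, hs, show b + -c = b - c by ring, show -a * -c = a * c by ring]
  ring

lemma eta_mul_add {a b c d : ℤ} (k : ℤ) (z : ℂ) :
    ((a : ℂ) * z + b) / (c * z + d) =
      (a * (z + k) + ((b - k * a : ℤ) : ℂ)) / (c * (z + k) + ((d - k * c : ℤ) : ℂ)) := by
  congr 1 <;> push_cast <;> ring

/-- Consistency of the multiplier with `η(z + k) = e24 k * η(z)`. Modulo 8 only the linear terms
survive, since `c² ≡ 1`; modulo 3 it is a finite check. -/
lemma exponent_shift {a b c d : ℤ} (hc : Odd c) (k : ℤ) (h : a * d - b * c = 1) :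
    (24 : ℤ) ∣ ((a + d) * c - b * d * (c ^ 2 - 1) - 3 * c + 3) -
      ((a + (d - k * c)) * c - (b - k * a) * (d - k * c) * (c ^ 2 - 1) - 3 * c + 3 + k) := by
  refine dvd_24_of ?_ ?_
  · refine (ZMod.intCast_zmod_eq_zero_iff_dvd _ 3).1 ?_
    have h' := congrArg (Int.cast : ℤ → ZMod 3) h
    push_cast at h' ⊢
    generalize (a : ZMod 3) = a, (b : ZMod 3) = b, (c : ZMod 3) = c, (d : ZMod 3) = d,
      (k : ZMod 3) = k at *
    revert a b c d k
    decide
  · have h8 := Int.eight_dvd_sq_sub_one_of_odd hc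
    obtain ⟨m, hm⟩ := h8
    refine ⟨k * m + (-(b * d) + (b - k * a) * (d - k * c)) * m, ?_⟩
    linear_combination (k - b * d + (b - k * a) * (d - k * c)) * hm

/-- On the right, `12 l` is the sign `J(-1 | d)`, `12 k l` is the sign of quadratic reciprocity, and
`3` is the square root of `I`. -/
lemma exponent_flip_pos {a b c d k l : ℤ} (hc : c = 2 * k + 1) (hd : d = 2 * l + 1)
    (h : a * d - b * c = 1) :
    (a + d) * c - b * d * (c ^ 2 - 1) - 3 * c + 3 =
      12 * (l + k * l) + ((b - c) * d - a * c * (d ^ 2 - 1) - 3 * d + 3) + 3 := by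
  subst hc hd
  linear_combination (2 * k + 1) * (2 * l + 1) * h

/-- As in the positive case, applied to the negated matrix: the sign `12 k` now comes from `J(-1 |
c)`, and `-3` is the square root of `-I`. -/
lemma exponent_flip_neg {a b c d k l : ℤ} (hc : c = 2 * k + 1) (hd : d = 2 * l + 1)
    (h : a * -d - b * c = 1) :
    (a + -d) * c - b * -d * (c ^ 2 - 1) - 3 * c + 3 =
      24 * (-k * (l + 1)) +
        (12 * (k + k * l) + ((-b - -c) * d - -a * -c * (d ^ 2 - 1) - 3 * d + 3) + -3) := by
  subst hc hd
  linear_combination -(2 * k + 1) * (2 * l + 1) * h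

lemma jacobiSym_neg_left_eq (a : ℤ) {b k : ℕ} (hb : b = 2 * k + 1) :
    J(-a | b) = (-1) ^ k * J(a | b) := by
  rw [jacobiSym.neg a ⟨k, hb⟩, ZMod.χ₄_eq_neg_one_pow (by omega), show b / 2 = k by omega]

lemma jacobiSym_flip {c d k l : ℕ} (hc : c = 2 * k + 1) (hd : d = 2 * l + 1) :
    J(c | d) = (-1) ^ (k * l) * J(d | c) := by
  rw [jacobiSym.quadratic_reciprocity ⟨k, hc⟩ ⟨l, hd⟩, show c / 2 = k by omega,
    show d / 2 = l by omega]

lemma etaTransform_one : EtaTransform 1 := by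
  intro a b d h z hz
  have hzd : 0 < (z + d).im := by simpa using hz
  have h0 := ne_zero_of_im_pos hzd
  have h1 : ((a : ℂ) * z + b) / ((1 : ℕ) * z + d) = -1 / (z + d) + a := by
    have h' : (a * d - b : ℂ) = 1 := by exact_mod_cast (by simpa using h : a * d - b = 1)
    push_cast
    rw [one_mul]
    field_simp
    linear_combination -h'
  rw [h1, eta_add_int, eta_neg_one_div hzd, eta_add_int]
  simp only [jacobiSym.one_right, Nat.cast_one, one_pow, sub_self, mul_zero, mul_one, one_mul,
    Int.cast_one]
  rw [show a + d - 0 - 3 + 3 = a + d by ring, e24_add]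
  ring

/-- The descent step for `0 < d`. -/
lemma etaTransform_flip_pos {c d : ℕ} (hc : Odd c) (hd : Odd d) (hE : EtaTransform d) {a b : ℤ}
    (h : a * d - b * c = 1) {z : ℂ} (hz : 0 < z.im) :
    eta ((a * z + b) / (c * z + d)) =
      (J(d | c) : ℂ) * e24 ((a + d) * c - b * d * (c ^ 2 - 1) - 3 * c + 3) *
        (-I * (c * z + d)).sqrt * eta z := by
  obtain ⟨k, hk⟩ := hc
  obtain ⟨l, hl⟩ := hd
  have h1 := eta_of_odd_right (by omega) hE (c := c) h hz
  rw [Int.cast_natCast] at h1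
  have hre : 0 < (-I * (c * z + d)).re := by
    have : 0 < (c : ℝ) * z.im := mul_pos (by exact_mod_cast (by omega : 0 < c)) hz
    simpa using this
  have hs : (c * z + d : ℂ).sqrt = e24 3 * (-I * (c * z + d)).sqrt := by
    rw [← sqrt_I_mul hre, ← mul_assoc]
    simp
  rw [h1, hs, exponent_flip_pos (k := k) (l := l) (by exact_mod_cast hk) (by exact_mod_cast hl) h,
    e24_add (12 * _ + _) 3, e24_add (12 * _), jacobiSym_neg_left_eq c hl, jacobiSym_flip hk hl,
    show (l + k * l : ℤ) = ((l + k * l : ℕ) : ℤ) by push_cast; ring, e24_12_mul]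
  push_cast
  ring

/-- The descent step for negative lower right entry. -/
lemma etaTransform_flip_neg {c d : ℕ} (hc : Odd c) (hd : Odd d) (hE : EtaTransform d) {a b : ℤ}
    (h : a * -d - b * c = 1) {z : ℂ} (hz : 0 < z.im) :
    eta ((a * z + b) / (c * z + ((-d : ℤ) : ℂ))) =
      (J(-d | c) : ℂ) * e24 ((a + -d) * c - b * -d * (c ^ 2 - 1) - 3 * c + 3) *
        (-I * (c * z + ((-d : ℤ) : ℂ))).sqrt * eta z := by
  obtain ⟨k, hk⟩ := hc
  obtain ⟨l, hl⟩ := hd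
  have h1 := eta_of_odd_right (by omega) hE (a := -a) (b := -b) (c := -c) (by linarith) hz
  have hre : 0 < (-I * (c * z + ((-d : ℤ) : ℂ))).re := by
    have : 0 < (c : ℝ) * z.im := mul_pos (by exact_mod_cast (by omega : 0 < c)) hz
    simpa using this
  have hs : (((-c : ℤ) : ℂ) * z + d : ℂ).sqrt =
      e24 (-3) * (-I * (c * z + ((-d : ℤ) : ℂ))).sqrt := by
    rw [← sqrt_neg_I_mul hre, ← mul_assoc]
    congr 1
    push_cast
    simp
    ring
  have h2 : (((-a : ℤ) : ℂ) * z + ((-b : ℤ) : ℂ)) / (((-c : ℤ) : ℂ) * z + d) =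
      (a * z + b) / (c * z + ((-d : ℤ) : ℂ)) := by
    rw [← neg_div_neg_eq]
    congr 1 <;> push_cast <;> ring
  rw [h2, hs] at h1
  rw [h1, exponent_flip_neg (k := k) (l := l) (by exact_mod_cast hk) (by exact_mod_cast hl) h,
    e24_add (24 * _), e24_mul_24, e24_add (12 * _ + _) (-3), e24_add (12 * _),
    jacobiSym_neg_left_eq d hk, jacobiSym_flip hl hk, neg_neg,
    show (k + k * l : ℤ) = ((k + l * k : ℕ) : ℤ) by push_cast; ring, e24_12_mul]
  push_cast
  rcases neg_one_pow_eq_or ℂ k with h3 | h3 <;>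
    rcases neg_one_pow_eq_or ℂ (l * k) with h4 | h4 <;> rw [pow_add, h3, h4] <;> ring

lemma jacobiSym_sub_mul (d k : ℤ) (c : ℕ) : J(d - k * c | c) = J(d | c) :=
  jacobiSym.mod_left' (by simp [Int.sub_emod])

/-- Division with odd remainder: as `c` is odd, exactly one of the remainders `e` and `e - c` is
odd. Oddness is what lets the Jacobi symbol be inverted at every step of the descent. -/
lemma exists_odd_shift {c : ℕ} (hc : Odd c) (h1 : c ≠ 1) {d : ℤ} (hd : IsCoprime d c) :
    ∃ (k : ℤ) (e : ℕ), Odd e ∧ e < c ∧ (d - k * c = e ∨ d - k * c = -e) := by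
  have hc0 : (0 : ℤ) < c := by exact_mod_cast hc.pos
  have hr := Int.emod_add_mul_ediv d c
  have hr0 := Int.emod_nonneg d hc0.ne'
  have hrc := Int.emod_lt_of_pos d hc0
  obtain ⟨e, he⟩ := Int.eq_ofNat_of_zero_le hr0
  rcases Nat.even_or_odd e with h | h
  · have he0 : e ≠ 0 := by
      rintro rfl
      have hdvd : (c : ℤ) ∣ d := Int.dvd_of_emod_eq_zero (by simpa using he)
      have := hd.isUnit_of_dvd' hdvd dvd_rfl
      rw [Int.isUnit_iff] at this
      omega
    refine ⟨d / c + 1, c - e, Nat.Odd.sub_even (by omega) hc h, by omega, Or.inr ?_⟩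
    rw [Nat.cast_sub (by omega)]
    linarith
  · refine ⟨d / c, e, h, by omega, Or.inl ?_⟩
    linarith

/-- Strong induction on `c`: shifting `z` by `k` replaces `(b, d)` by `(b - ka, d - kc)`, and the
flip then uses the formula for the smaller odd number `|d - kc|`. -/
theorem etaTransform_of_odd {c : ℕ} (hc : Odd c) : EtaTransform c := by
  induction c using Nat.strong_induction_on with
  | _ c ih =>
  rcases eq_or_ne c 1 with rfl | h1
  · exact etaTransform_one
  intro a b d h z hz
  obtain ⟨k, e, he, hec, hk⟩ := exists_odd_shift hc h1 (d := d) ⟨a, -b, by linarith⟩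
  have hzk : 0 < (z + k).im := by simpa using hz
  have hdet : a * (d - k * c) - (b - k * a) * c = 1 := by linarith
  have hden : (c * (z + k) + ((d - k * c : ℤ) : ℂ)) = c * z + d := by push_cast; ring
  have key : eta ((a * (z + k) + ((b - k * a : ℤ) : ℂ)) / (c * (z + k) + ((d - k * c : ℤ) : ℂ))) =
      (J(d - k * c | c) : ℂ) * e24 ((a + (d - k * c)) * c -
        (b - k * a) * (d - k * c) * (c ^ 2 - 1) - 3 * c + 3) *
        (-I * (c * (z + k) + ((d - k * c : ℤ) : ℂ))).sqrt * eta (z + k) := by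
    rcases hk with hk | hk
    · rw [hk] at hdet ⊢
      exact etaTransform_flip_pos hc he (ih e hec he) hdet hzk
    · rw [hk] at hdet ⊢
      exact etaTransform_flip_neg hc he (ih e hec he) hdet hzk
  have hm := eta_mul_add (a := a) (b := b) (c := c) (d := d) k z
  rw [Int.cast_natCast] at hm
  rw [hm, key, hden, eta_add_int, jacobiSym_sub_mul,
    e24_congr (exponent_shift (by exact_mod_cast hc) k h), e24_add _ k]
  ring

/-! Puiseux expansions of products of `η`-functions. -/

/-- `f(z) = q^ord G(q^(1/m))` for a holomorphic function `G` without zeros on the unit disc, and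
`G(0) = l`. -/
def IsPuiseuxUnit (f : ℂ → ℂ) (ord : ℚ) (l : ℂ) : Prop :=
  ∃ (m : ℕ) (G : ℂ → ℂ), 0 < m ∧ DifferentiableOn ℂ G (Metric.ball 0 1) ∧
    (∀ t ∈ Metric.ball (0 : ℂ) 1, G t ≠ 0) ∧ G 0 = l ∧
    ∀ z : ℂ, 0 < z.im → f z = Complex.exp (2 * Real.pi * I * ord * z) *
      G (Complex.exp (2 * Real.pi * I * (z / m)))

lemma norm_exp_two_pi_I_mul_lt_one {z : ℂ} (hz : 0 < z.im) :
    ‖Complex.exp (2 * Real.pi * I * z)‖ < 1 :=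
  UpperHalfPlane.norm_exp_two_pi_I_lt_one ⟨z, hz⟩

lemma div_natCast_im_pos {z : ℂ} (hz : 0 < z.im) {m : ℕ} (hm : 0 < m) : 0 < (z / m).im := by
  rw [Complex.div_natCast_im]
  positivity

lemma exp_div_mem_ball {z : ℂ} (hz : 0 < z.im) {m : ℕ} (hm : 0 < m) :
    Complex.exp (2 * Real.pi * I * (z / m)) ∈ Metric.ball (0 : ℂ) 1 := by
  rw [mem_ball_zero_iff]
  exact norm_exp_two_pi_I_mul_lt_one (div_natCast_im_pos hz hm)

lemma exp_div_mul_pow {z : ℂ} {m n : ℕ} (hn : 0 < n) :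
    Complex.exp (2 * Real.pi * I * (z / ((m * n : ℕ) : ℂ))) ^ n =
      Complex.exp (2 * Real.pi * I * (z / m)) := by
  rw [← Complex.exp_nat_mul]
  congr 1
  have : (n : ℂ) ≠ 0 := by exact_mod_cast hn.ne'
  push_cast
  field_simp

lemma pow_mem_unit_ball {t : ℂ} (ht : t ∈ Metric.ball (0 : ℂ) 1) {k : ℕ} (hk : k ≠ 0) :
    t ^ k ∈ Metric.ball (0 : ℂ) 1 := by
  rw [mem_ball_zero_iff] at *
  rw [norm_pow]
  exact pow_lt_one₀ (norm_nonneg _) ht hk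

/-- Both factors are rewritten in the common root `q^(1/(mn))`, whose `n`th and `m`th powers are the
original variables. -/
lemma IsPuiseuxUnit.mul {f g : ℂ → ℂ} {o o' : ℚ} {l l' : ℂ} (hf : IsPuiseuxUnit f o l)
    (hg : IsPuiseuxUnit g o' l') : IsPuiseuxUnit (fun z => f z * g z) (o + o') (l * l') := by
  obtain ⟨m, G, hm, hG, hG0, hGl, hfG⟩ := hf
  obtain ⟨n, H, hn, hH, hH0, hHl, hgH⟩ := hg
  refine ⟨m * n, fun t => G (t ^ n) * H (t ^ m), Nat.mul_pos hm hn, ?_, ?_, ?_, ?_⟩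
  · exact (hG.comp (by fun_prop) fun t ht => pow_mem_unit_ball ht hn.ne').mul
      (hH.comp (by fun_prop) fun t ht => pow_mem_unit_ball ht hm.ne')
  · exact fun t ht => mul_ne_zero (hG0 _ (pow_mem_unit_ball ht hn.ne'))
      (hH0 _ (pow_mem_unit_ball ht hm.ne'))
  · simp [hn.ne', hm.ne', hGl, hHl]
  · intro z hz
    have h2 : Complex.exp (2 * Real.pi * I * (z / ((m * n : ℕ) : ℂ))) ^ m =
        Complex.exp (2 * Real.pi * I * (z / n)) := by
      rw [mul_comm m n]
      exact exp_div_mul_pow hm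
    simp only [hfG z hz, hgH z hz, h2, exp_div_mul_pow hn]
    rw [show (2 * Real.pi * I * ((o + o' : ℚ) : ℂ) * z : ℂ) =
      2 * Real.pi * I * o * z + 2 * Real.pi * I * o' * z by push_cast; ring, Complex.exp_add]
    ring

lemma IsPuiseuxUnit.inv {f : ℂ → ℂ} {o : ℚ} {l : ℂ} (hf : IsPuiseuxUnit f o l) :
    IsPuiseuxUnit (fun z => (f z)⁻¹) (-o) l⁻¹ := by
  obtain ⟨m, G, hm, hG, hG0, hGl, hfG⟩ := hf
  refine ⟨m, fun t => (G t)⁻¹, hm, hG.inv hG0, fun t ht => inv_ne_zero (hG0 t ht), by simp only [hGl],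
    fun z hz => ?_⟩
  simp only [hfG z hz, mul_inv]
  rw [← Complex.exp_neg]
  congr 2
  push_cast
  ring

lemma IsPuiseuxUnit.div {f g : ℂ → ℂ} {o o' : ℚ} {l l' : ℂ} (hf : IsPuiseuxUnit f o l)
    (hg : IsPuiseuxUnit g o' l') : IsPuiseuxUnit (fun z => f z / g z) (o - o') (l / l') := by
  simpa only [div_eq_mul_inv, sub_eq_add_neg] using hf.mul hg.inv

lemma isPuiseuxUnit_const {c : ℂ} (hc : c ≠ 0) : IsPuiseuxUnit (fun _ => c) 0 c :=
  ⟨1, fun _ => c, one_pos, by fun_prop, fun _ _ => hc, rfl, by simp⟩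

lemma IsPuiseuxUnit.const_mul {f : ℂ → ℂ} {o : ℚ} {l c : ℂ} (hc : c ≠ 0)
    (hf : IsPuiseuxUnit f o l) : IsPuiseuxUnit (fun z => c * f z) o (c * l) := by
  simpa using (isPuiseuxUnit_const hc).mul hf

lemma IsPuiseuxUnit.congr {f g : ℂ → ℂ} {o o' : ℚ} {l l' : ℂ} (hf : IsPuiseuxUnit f o l)
    (hfg : ∀ z : ℂ, 0 < z.im → g z = f z) (ho : o' = o) (hl : l' = l) :
    IsPuiseuxUnit g o' l' := by
  obtain ⟨m, G, hm, hG, hG0, hGl, hfG⟩ := hf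
  exact ⟨m, G, hm, hG, hG0, hGl.trans hl.symm, fun z hz => by rw [hfg z hz, hfG z hz, ho]⟩

/-- The Taylor series of `G` at 0 converges on the whole unit disc, and `q^(1/m)` stays in that disc
for every `z` in the upper half-plane. -/
lemma IsPuiseuxUnit.hasQLeadingTerm {f : ℂ → ℂ} {o : ℚ} {l : ℂ} (hf : IsPuiseuxUnit f o l) :
    HasQLeadingTerm f o l := by
  obtain ⟨m, G, hm, hG, hG0, hGl, hfG⟩ := hf
  refine ⟨hGl ▸ hG0 0 (by simp), m, fun n => (n.factorial : ℂ)⁻¹ * iteratedDeriv n G 0, hm,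
    by simpa using hGl, fun z hz => ?_⟩
  have h := (Complex.hasSum_taylorSeries_on_ball hG (exp_div_mem_ball hz hm)).mul_left
    (Complex.exp (2 * Real.pi * I * o * z))
  rw [← hfG z hz] at h
  convert! h using 2 with n
  rw [sub_zero, smul_eq_mul, smul_eq_mul, ← Complex.exp_nat_mul, show
    (2 * Real.pi * I * (o + n / m) * z : ℂ) =
      2 * Real.pi * I * o * z + n * (2 * Real.pi * I * (z / m)) by ring, Complex.exp_add]
  ring

lemma tprod_one_sub_pow_ne_zero {t : ℂ} (ht : t ∈ Metric.ball (0 : ℂ) 1) :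
    ∏' n : ℕ, (1 - t ^ (n + 1)) ≠ 0 := by
  rw [mem_ball_zero_iff] at ht
  refine tprod_one_add_ne_zero_of_summable (f := fun n => -t ^ (n + 1)) (fun i h => ?_) ?_
  · have h1 : t ^ (i + 1) = 1 := by linear_combination -h
    have h2 := pow_lt_one₀ (norm_nonneg t) ht i.succ_ne_zero
    rw [← norm_pow, h1] at h2
    simp at h2
  · simpa using (summable_nat_add_iff 1).mpr (summable_geometric_of_lt_one (norm_nonneg _) ht)

lemma eta_eq_exp_mul (w : ℂ) : eta w = Complex.exp (2 * Real.pi * I * w / 24) *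
    ∏' n : ℕ, (1 - Complex.exp (2 * Real.pi * I * w) ^ (n + 1)) := by
  simp only [eta, eta_q_eq_pow, Function.Periodic.qParam, ofReal_ofNat]

lemma norm_exp_two_pi_I_mul_ratCast (β : ℚ) : ‖Complex.exp (2 * Real.pi * I * β)‖ = 1 := by
  rw [show (2 * Real.pi * I * β : ℂ) = ((2 * Real.pi * β : ℝ) : ℂ) * I by push_cast; ring]
  exact Complex.norm_exp_ofReal_mul_I _

/-- With `α = k / m` in lowest terms, `q` evaluated at `αz + β` is `exp(2πiβ) t^k` for `t =
q^(1/m)`. Positivity of `k` makes the infinite product equal to 1 at `t = 0`. -/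
lemma isPuiseuxUnit_eta {α : ℚ} (hα : 0 < α) (β : ℚ) :
    IsPuiseuxUnit (fun z => eta (α * z + β)) (α / 24) (zetaPow 24 β) := by
  obtain ⟨k, hk⟩ := Int.eq_ofNat_of_zero_le (Rat.num_nonneg.2 hα.le)
  have hk0 : k ≠ 0 := by
    rintro rfl
    exact (Rat.num_pos.2 hα).ne' hk
  have hmem : ∀ t ∈ Metric.ball (0 : ℂ) 1,
      Complex.exp (2 * Real.pi * I * β) * t ^ k ∈ Metric.ball (0 : ℂ) 1 := by
    intro t ht
    have := pow_mem_unit_ball ht hk0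
    rw [mem_ball_zero_iff] at this ⊢
    rwa [norm_mul, norm_exp_two_pi_I_mul_ratCast, one_mul]
  have hαe : (α : ℂ) = k / α.den := by
    have h := Rat.num_div_den α
    rw [hk] at h
    conv_lhs => rw [← h]
    push_cast
    rfl
  refine ⟨α.den, fun t => zetaPow 24 β *
    ∏' n : ℕ, (1 - (Complex.exp (2 * Real.pi * I * β) * t ^ k) ^ (n + 1)), α.pos, ?_, ?_, ?_, ?_⟩
  · exact (differentiableOn_const _).mul
      (differentiableOn_tprod_one_sub_pow.comp (by fun_prop) hmem)
  · exact fun t ht => mul_ne_zero (Complex.exp_ne_zero _) (tprod_one_sub_pow_ne_zero (hmem t ht))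
  · simp [hk0]
  · intro z hz
    have h1 : Complex.exp (2 * Real.pi * I * β) *
        Complex.exp (2 * Real.pi * I * (z / α.den)) ^ k =
        Complex.exp (2 * Real.pi * I * (α * z + β)) := by
      rw [← Complex.exp_nat_mul, ← Complex.exp_add, hαe]
      congr 1
      ring
    simp only [h1]
    rw [eta_eq_exp_mul, ← mul_assoc, zetaPow, ← Complex.exp_add]
    congr 2
    push_cast
    ring

/-! Convenient forms of the transformation formula. -/

lemma eta_eq_of_odd_left {c : ℕ} (hc : Odd c) {a b d : ℤ} (hdet : a * d - b * c = 1)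
    {x y e : ℂ} (hy : 0 < y.im) (he : c * y + d = e) (hx : a * y + b = x * e) :
    eta x = (J(d | c) : ℂ) * e24 ((a + d) * c - b * d * (c ^ 2 - 1) - 3 * c + 3) *
      (-I * e).sqrt * eta y := by
  have h0 : e ≠ 0 := by
    rw [← he]
    simpa using denom_ne_zero (c := (c : ℤ)) hdet hy
  rw [eq_div_of_mul_eq h0 hx.symm, ← he]
  exact etaTransform_of_odd hc a b d hdet y hy

lemma eta_eq_of_odd_right {d : ℕ} (hd : Odd d) {a b c : ℤ} (hdet : a * d - b * c = 1)
    {x y e : ℂ} (hy : 0 < y.im) (he : c * y + d = e) (hx : a * y + b = x * e) :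
    eta x = (J(-c | d) : ℂ) * e24 ((b - c) * d - a * c * (d ^ 2 - 1) - 3 * d + 3) *
      e.sqrt * eta y := by
  have h0 : e ≠ 0 := by
    rw [← he]
    simpa using denom_ne_zero (d := (d : ℤ)) hdet hy
  rw [eq_div_of_mul_eq h0 hx.symm, ← he]
  exact eta_of_odd_right hd.pos (etaTransform_of_odd hd) hdet hy

/-- Each weight factor `s`, `t` occurs once in the numerator and once in the denominator, so only
the constants `kᵢ` have to be compared. -/
lemma quotient_eq {x₁ x₂ x₃ x₄ y₁ y₂ y₃ y₄ k₁ k₂ k₃ k₄ s t F : ℂ} (h₁ : x₁ = k₁ * s * y₁)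
    (h₂ : x₂ = k₂ * t * y₂) (h₃ : x₃ = k₃ * s * y₃) (h₄ : x₄ = k₄ * t * y₄)
    (hs : s ≠ 0) (ht : t ≠ 0) (hk₃ : k₃ ≠ 0) (hk₄ : k₄ ≠ 0) (hF : k₁ * k₂ = F * (k₃ * k₄)) :
    x₁ * x₂ / (x₃ * x₄) = F * (y₁ * y₂ / (y₃ * y₄)) := by
  rw [h₁, h₂, h₃, h₄]
  calc k₁ * s * y₁ * (k₂ * t * y₂) / (k₃ * s * y₃ * (k₄ * t * y₄))
      = (k₁ * k₂) / (k₃ * k₄) * (s / s) * (t / t) * (y₁ * y₂ / (y₃ * y₄)) := by ring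
    _ = _ := by
      rw [hF, div_self hs, div_self ht, mul_div_cancel_right₀ _ (mul_ne_zero hk₃ hk₄)]
      ring

/-! Invariance under `Γ⁰(N)`. -/

lemma exponent_mul_s (p₁ p₂ : ℕ) (h₁ : 1 ≤ p₁) (h₂ : 1 ≤ p₂) :
    (24 : ℤ) ∣ s p₁ p₂ * (((p₁ : ℤ) - 1) * ((p₂ : ℤ) - 1)) := by
  have h : 24 ∣ s p₁ p₂ * ((p₁ - 1) * (p₂ - 1)) := by
    obtain ⟨k, hk⟩ := Nat.gcd_dvd_right 24 ((p₁ - 1) * (p₂ - 1))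
    refine ⟨k, ?_⟩
    conv_lhs => rw [hk]
    rw [← mul_assoc, s, Nat.div_mul_cancel (Nat.gcd_dvd_left _ _)]
  have h' : ((24 : ℕ) : ℤ) ∣ ((s p₁ p₂ * ((p₁ - 1) * (p₂ - 1)) : ℕ) : ℤ) :=
    Int.natCast_dvd_natCast.2 h
  rw [Nat.cast_mul, Nat.cast_mul, Nat.cast_sub h₁, Nat.cast_sub h₂] at h'
  simpa using h'

lemma e24_pow_s {p₁ p₂ : ℕ} (h₁ : 1 ≤ p₁) (h₂ : 1 ≤ p₂) (k : ℤ) :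
    e24 (((p₁ : ℤ) - 1) * ((p₂ : ℤ) - 1) * k) ^ s p₁ p₂ = 1 := by
  rw [e24_pow, ← e24_zero]
  refine e24_congr ?_
  rw [sub_zero, ← mul_assoc]
  exact (exponent_mul_s p₁ p₂ h₁ h₂).mul_right k

lemma w_add_int_mul {p₁ p₂ : ℕ} (h₁ : 1 ≤ p₁) (h₂ : 1 ≤ p₂) (z : ℂ) (k : ℤ) :
    w p₁ p₂ (z + (k * (p₁ * p₂) : ℤ)) =
      e24 (((p₁ : ℤ) - 1) * ((p₂ : ℤ) - 1) * -k) * w p₁ p₂ z := by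
  have h₁' : (p₁ : ℂ) ≠ 0 := by exact_mod_cast (by omega : p₁ ≠ 0)
  have h₂' : (p₂ : ℂ) ≠ 0 := by exact_mod_cast (by omega : p₂ ≠ 0)
  have e₁ : (z + (k * (p₁ * p₂) : ℤ)) / p₁ = z / p₁ + (k * p₂ : ℤ) := by
    push_cast; field_simp
  have e₂ : (z + (k * (p₁ * p₂) : ℤ)) / p₂ = z / p₂ + (k * p₁ : ℤ) := by
    push_cast; field_simp
  have e₃ : (z + (k * (p₁ * p₂) : ℤ)) / (p₁ * p₂) = z / (p₁ * p₂) + k := by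
    push_cast; field_simp
  rw [w, w, e₁, e₂, e₃]
  refine quotient_eq (k₁ := e24 (k * p₂)) (k₂ := e24 (k * p₁)) (k₃ := e24 k)
    (k₄ := e24 (k * (p₁ * p₂))) (s := 1) (t := 1) ?_ ?_ ?_ ?_ one_ne_zero one_ne_zero
    (e24_ne_zero _) (e24_ne_zero _) ?_
  · rw [eta_add_int, mul_one]
  · rw [eta_add_int, mul_one]
  · rw [eta_add_int, mul_one]
  · rw [eta_add_int, mul_one]
  · rw [← e24_add, ← e24_add, ← e24_add]
    congr 1
    ring

/-- For `qt = N`, conjugation by `z ↦ z/q` sends the matrix to `(a, tb; qc, d)`. All four `η`-values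
thus share `d` and the same square root, and the symbols cancel by `J(p₁ | d) J(p₂ | d) = J(p₁p₂ |
d)`. -/
lemma w_smul_pow_of_odd_pos {p₁ p₂ : ℕ} (h₁ : 1 ≤ p₁) (h₂ : 1 ≤ p₂) {a b c : ℤ} {d : ℕ}
    (hd : Odd d) (hdet : a * d - p₁ * p₂ * b * c = 1) {z : ℂ} (hz : 0 < z.im) :
    w p₁ p₂ ((a * z + ((p₁ * p₂ * b : ℤ) : ℂ)) / (c * z + d)) ^ s p₁ p₂ =
      w p₁ p₂ z ^ s p₁ p₂ := by
  have h₁' : (p₁ : ℂ) ≠ 0 := by exact_mod_cast (by omega : p₁ ≠ 0)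
  have h₂' : (p₂ : ℂ) ≠ 0 := by exact_mod_cast (by omega : p₂ ≠ 0)
  have hden : (c * z + d : ℂ) ≠ 0 := by
    simpa using denom_ne_zero (d := (d : ℤ)) hdet hz
  have hJ : ∀ q : ℕ, J(-(q * c) | d) = J(-c | d) * J(q | d) := by
    intro q
    rw [← jacobiSym.mul_left]
    congr 1
    ring
  have hN : J(-((p₁ * p₂ : ℕ) * c) | d) = J(-c | d) * (J(p₁ | d) * J(p₂ | d)) := by
    rw [hJ, Nat.cast_mul, jacobiSym.mul_left]
  have hco : IsCoprime (p₁ * p₂ * c : ℤ) d := ⟨-b, a, by linarith⟩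
  have hc0 : J(-c | d) ≠ 0 := jacobiSym.ne_zero (Int.isCoprime_iff_gcd_eq_one.1
    (hco.of_mul_left_right.neg_left))
  have hp₁ : J(p₁ | d) ≠ 0 := jacobiSym.ne_zero (Int.isCoprime_iff_gcd_eq_one.1
    hco.of_mul_left_left.of_mul_left_left)
  have hp₂ : J(p₂ | d) ≠ 0 := jacobiSym.ne_zero (Int.isCoprime_iff_gcd_eq_one.1
    hco.of_mul_left_left.of_mul_left_right)
  set x := (a * z + ((p₁ * p₂ * b : ℤ) : ℂ)) / (c * z + d) with hx
  have hx' : a * z + p₁ * p₂ * b = x * (c * z + d) := by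
    rw [hx, div_mul_cancel₀ _ hden]
    push_cast
    ring
  have key : ∀ q t : ℕ, 1 ≤ q → (q * t = p₁ * p₂) →
      eta (x / q) = (J(-(q * c) | d) : ℂ) *
        e24 ((t * b - q * c) * d - a * (q * c) * (d ^ 2 - 1) - 3 * d + 3) *
        (c * z + d : ℂ).sqrt * eta (z / q) := by
    intro q t hq hqt
    have hq' : (q : ℂ) ≠ 0 := by exact_mod_cast (by omega : q ≠ 0)
    have hqt' : (q : ℤ) * t = p₁ * p₂ := by exact_mod_cast hqt
    have hqt'' : (q : ℂ) * t = p₁ * p₂ := by exact_mod_cast hqt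
    refine eta_eq_of_odd_right hd (a := a) (b := t * b) (c := q * c) ?_
      (div_natCast_im_pos hz hq) ?_ ?_
    · rw [← hqt'] at hdet
      linarith
    · push_cast
      field_simp
    · push_cast
      rw [div_mul_eq_mul_div, eq_div_iff hq', ← hx', ← hqt'']
      field_simp
  have hw : w p₁ p₂ x = e24 (((p₁ : ℤ) - 1) * ((p₂ : ℤ) - 1) *
      -(b * d - c * d - a * c * (d ^ 2 - 1))) * w p₁ p₂ z := by
    have k₃ := key (p₁ * p₂) 1 (Nat.mul_pos h₁ h₂) (mul_one _)
    have k₄ := key 1 (p₁ * p₂) le_rfl (one_mul _)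
    rw [Nat.cast_mul] at k₃
    rw [Nat.cast_one, div_one, div_one] at k₄
    rw [w, w]
    refine quotient_eq (key p₁ p₂ h₁ rfl) (key p₂ p₁ h₂ (mul_comm _ _)) k₃ k₄
      (sqrt_ne_zero hden) (sqrt_ne_zero hden) ?_ ?_ ?_
    · refine mul_ne_zero (Int.cast_ne_zero.2 ?_) (e24_ne_zero _)
      rw [hN]
      exact mul_ne_zero hc0 (mul_ne_zero hp₁ hp₂)
    · refine mul_ne_zero (Int.cast_ne_zero.2 ?_) (e24_ne_zero _)
      simpa using hc0
    · rw [hJ p₁, hJ p₂, hN, Nat.cast_one, one_mul]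
      have hE : ∀ A B C D E : ℤ, A + B = C + (D + E) →
          e24 A * e24 B = e24 C * (e24 D * e24 E) := by
        intro A B C D E h
        rw [← e24_add, ← e24_add, ← e24_add, h]
      push_cast
      rw [mul_mul_mul_comm, hE _ _ (((p₁ : ℤ) - 1) * ((p₂ : ℤ) - 1) *
        -(b * d - c * d - a * c * (d ^ 2 - 1)))
        ((1 * b - p₁ * p₂ * c) * d - a * (p₁ * p₂ * c) * (d ^ 2 - 1) - 3 * d + 3)
        ((p₁ * p₂ * b - c) * d - a * c * (d ^ 2 - 1) - 3 * d + 3) (by ring)]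
      simp only [one_mul]
      ring
  rw [hw, mul_pow, e24_pow_s h₁ h₂, one_mul]

lemma w_smul_pow_of_odd {p₁ p₂ : ℕ} (h₁ : 1 ≤ p₁) (h₂ : 1 ≤ p₂) {a b c d : ℤ}
    (hd : Odd d) (hdet : a * d - p₁ * p₂ * b * c = 1) {z : ℂ} (hz : 0 < z.im) :
    w p₁ p₂ ((a * z + ((p₁ * p₂ * b : ℤ) : ℂ)) / (c * z + d)) ^ s p₁ p₂ =
      w p₁ p₂ z ^ s p₁ p₂ := by
  obtain ⟨n, rfl | rfl⟩ := Int.eq_nat_or_neg d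
  · simpa using w_smul_pow_of_odd_pos h₁ h₂ (by exact_mod_cast hd) hdet hz
  · rw [odd_neg] at hd
    have h := w_smul_pow_of_odd_pos h₁ h₂ (a := -a) (b := -b) (c := -c) (d := n)
      (by exact_mod_cast hd) (by linarith) hz
    rw [← h, ← neg_div_neg_eq]
    congr 3 <;> push_cast <;> ring

lemma coe_smul_eq (g : SL(2, ℤ)) (z : ℍ) : ((g • z : ℍ) : ℂ) =
    ((g 0 0 : ℤ) * z + (g 0 1 : ℤ)) / ((g 1 0 : ℤ) * z + (g 1 1 : ℤ)) := by
  simpa using UpperHalfPlane.coe_specialLinearGroup_apply g z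

theorem w_smul_pow {p₁ p₂ : ℕ} (h₁ : 1 ≤ p₁) (h₂ : 1 ≤ p₂) {g : SL(2, ℤ)}
    (hg : g ∈ GammaUpper0 (p₁ * p₂)) (z : ℍ) :
    w p₁ p₂ ((g • z : ℍ) : ℂ) ^ s p₁ p₂ = w p₁ p₂ (z : ℂ) ^ s p₁ p₂ := by
  rw [coe_smul_eq]
  have hdet := g.det_coe
  rw [Matrix.det_fin_two] at hdet
  obtain ⟨b, hb⟩ : ((p₁ * p₂ : ℕ) : ℤ) ∣ g 0 1 := hg
  rw [Nat.cast_mul] at hb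
  generalize g 0 0 = a at *
  generalize g 0 1 = b' at *
  generalize g 1 0 = c at *
  generalize g 1 1 = d at *
  subst hb
  rcases Int.even_or_odd d with hd | hd
  · have hodd : Odd (((p₁ : ℤ) * p₂ * b) * c) := by
      rw [show (p₁ : ℤ) * p₂ * b * c = a * d - 1 by linarith]
      exact (hd.mul_left a).sub_odd odd_one
    have hc := (Int.odd_mul.1 hodd).2
    have hN := (Int.odd_mul.1 (Int.odd_mul.1 hodd).1).1
    have hz : 0 < ((z : ℂ) + ((-1 * (p₁ * p₂) : ℤ) : ℂ)).im := by simpa using z.im_pos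
    -- For `d` even, `c` and `N` are odd. Multiplying on the right by `T^N` makes the lower right
    -- entry `d + cN` odd, and translation by `-N` costs a root of unity killed by `s`.
    have h := w_smul_pow_of_odd h₁ h₂ (a := a) (b := b + a) (c := c) (d := d + c * (p₁ * p₂))
      (hd.add_odd (hc.mul hN)) (by linarith) hz
    rw [w_add_int_mul h₁ h₂, mul_pow, e24_pow_s h₁ h₂, one_mul] at h
    rw [← h]
    congr 3 <;> push_cast <;> ring
  · exact w_smul_pow_of_odd h₁ h₂ hd hdet z.im_pos

/-! ### Orders and leading coefficients of `η`-quotients. -/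

lemma zetaPow_congr {m n : ℕ} (hm : m ≠ 0) (hn : n ≠ 0) {x y : ℚ} (h : x * n = y * m) :
    zetaPow m x = zetaPow n y := by
  have h' : (x * n : ℂ) = y * m := by exact_mod_cast congrArg (Rat.cast : ℚ → ℂ) h
  have hm' : (m : ℂ) ≠ 0 := Nat.cast_ne_zero.2 hm
  have hn' : (n : ℂ) ≠ 0 := Nat.cast_ne_zero.2 hn
  rw [zetaPow, zetaPow]
  congr 1
  field_simp
  linear_combination h'

lemma zetaPow_add (n : ℕ) (x y : ℚ) : zetaPow n (x + y) = zetaPow n x * zetaPow n y := by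
  rw [zetaPow, zetaPow, zetaPow, ← Complex.exp_add]
  congr 1
  push_cast
  ring

lemma zetaPow_neg (n : ℕ) (x : ℚ) : zetaPow n (-x) = (zetaPow n x)⁻¹ := by
  rw [zetaPow, zetaPow, ← Complex.exp_neg]
  congr 1
  push_cast
  ring

lemma hasQLeadingTerm_eta_quotient {f : ℂ → ℂ} {α₁ α₂ α₃ α₄ β₁ β₂ β₃ β₄ ord : ℚ} {c l : ℂ}
    (hc : c ≠ 0) (h₁ : 0 < α₁) (h₂ : 0 < α₂) (h₃ : 0 < α₃) (h₄ : 0 < α₄)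
    (hf : ∀ z : ℂ, 0 < z.im → f z = c * (eta (α₁ * z + β₁) * eta (α₂ * z + β₂) /
      (eta (α₃ * z + β₃) * eta (α₄ * z + β₄))))
    (hord : ord = (α₁ + α₂ - α₃ - α₄) / 24) (hl : l = c * zetaPow 24 (β₁ + β₂ - β₃ - β₄)) :
    HasQLeadingTerm f ord l := by
  refine IsPuiseuxUnit.hasQLeadingTerm
    (((((isPuiseuxUnit_eta h₁ β₁).mul (isPuiseuxUnit_eta h₂ β₂)).div
      ((isPuiseuxUnit_eta h₃ β₃).mul (isPuiseuxUnit_eta h₄ β₄))).const_mul hc).congr hf ?_ ?_)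
  · rw [hord]
    ring
  · rw [hl, show β₁ + β₂ - β₃ - β₄ = β₁ + β₂ + -(β₃ + β₄) by ring, zetaPow_add, zetaPow_neg,
      zetaPow_add, zetaPow_add, div_eq_mul_inv]

lemma sqrt_natCast_mul {p : ℕ} (hp : p ≠ 0) {x : ℂ} (hx : x ≠ 0) :
    (p * x : ℂ).sqrt = (p : ℂ).sqrt * x.sqrt := by
  refine sqrt_mul_of_arg (Nat.cast_ne_zero.2 hp) hx ?_
  rw [Complex.natCast_arg, zero_add]
  exact Complex.arg_mem_Ioc x

lemma neg_I_mul_ne_zero {z : ℂ} (hz : z ≠ 0) : -I * z ≠ 0 := mul_ne_zero (by simp) hz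

lemma natCast_mul_im_pos {z : ℂ} (hz : 0 < z.im) {p : ℕ} (hp : p ≠ 0) : 0 < (p * z : ℂ).im := by
  rw [← nsmul_eq_mul, Complex.smul_im]
  simpa using mul_pos (Nat.cast_pos.2 (Nat.pos_of_ne_zero hp)) hz

/-- `η (k - 1 / (p z))`. -/
lemma eta_int_sub_one_div {p : ℕ} (hp : p ≠ 0) (k : ℤ) {x z : ℂ} (hz : 0 < z.im)
    (hx : x * (p * z) = k * (p * z) - 1) :
    eta x = e24 k * (p : ℂ).sqrt * (-I * z).sqrt * eta (p * z) := by
  have hpz := natCast_mul_im_pos hz hp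
  have h0 := ne_zero_of_im_pos hpz
  have hx' : x = -1 / (p * z) + k := by
    rw [← eq_div_of_mul_eq h0 (show (x - k) * (p * z) = -1 by linear_combination hx)]
    ring
  rw [hx', eta_add_int, eta_neg_one_div hpz, show -I * (p * z) = p * (-I * z) by ring,
    sqrt_natCast_mul hp (neg_I_mul_ne_zero (ne_zero_of_im_pos hz))]
  ring

lemma coe_T_pow_smul (ν : ℕ) (z : ℍ) : ((ModularGroup.T ^ ν • z : ℍ) : ℂ) = z + ν := by
  have := ModularGroup.coe_T_zpow_smul_eq (z := z) (n := ν)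
  rw [zpow_natCast] at this
  simpa using this

lemma coe_S_smul (z : ℍ) : ((ModularGroup.S • z : ℍ) : ℂ) = -1 / z := by
  rw [coe_smul_eq]
  simp [ModularGroup.S]

lemma coe_M_smul (p : ℕ) (μ : ℤ) (z : ℍ) : ((M p μ • z : ℍ) : ℂ) = (μ * p * z - 1) / z := by
  rw [coe_smul_eq]
  simp [M, sub_eq_add_neg]

lemma coe_M0_smul (p₁ p₂ : ℕ) (u v : ℤ) (h : u * p₁ + v * p₂ = 1) (z : ℍ) :
    ((M0 p₁ p₂ u v h • z : ℍ) : ℂ) = (u * p₁ * z - v * p₂) / (z + 1) := by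
  rw [coe_smul_eq]
  simp [M0, sub_eq_add_neg]

/-! ### The conjugates by `T^ν` and `S`. -/

theorem A_eq_w (p₁ p₂ ν : ℕ) (z : ℂ) : A p₁ p₂ ν z = w p₁ p₂ (z + ν) := by
  rw [A, w, mul_comm (eta (z + ν))]

theorem isConjugate_A {p₁ p₂ : ℕ} (h₁ : p₁ ≠ 0) (h₂ : p₂ ≠ 0) (ν : ℕ) :
    IsConjugate p₁ p₂ (ModularGroup.T ^ ν) (A p₁ p₂ ν) (-r p₁ p₂ / (p₁ * p₂))
      (zetaPow (p₁ * p₂) (-(ν * r p₁ p₂))) := by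
  have h₁' : (0 : ℚ) < p₁ := Nat.cast_pos.2 (Nat.pos_of_ne_zero h₁)
  have h₂' : (0 : ℚ) < p₂ := Nat.cast_pos.2 (Nat.pos_of_ne_zero h₂)
  have h₁c : (p₁ : ℂ) ≠ 0 := Nat.cast_ne_zero.2 h₁
  have h₂c : (p₂ : ℂ) ≠ 0 := Nat.cast_ne_zero.2 h₂
  refine ⟨fun z => ?_, ?_⟩
  · rw [coe_T_pow_smul, A_eq_w]
  · refine hasQLeadingTerm_eta_quotient (c := 1) (α₁ := 1 / p₁) (β₁ := ν / p₁) (α₂ := 1 / p₂)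
      (β₂ := ν / p₂) (α₃ := 1) (β₃ := ν) (α₄ := 1 / (p₁ * p₂)) (β₄ := ν / (p₁ * p₂))
      one_ne_zero (by positivity) (by positivity) one_pos (by positivity) ?_ ?_ ?_
    · intro z _
      rw [A, one_mul]
      congr 3 <;> congr 1 <;> push_cast <;> field_simp
    · rw [r]
      field_simp
      ring
    · rw [one_mul]
      refine zetaPow_congr (mul_ne_zero h₁ h₂) (by norm_num) ?_
      rw [r]
      push_cast
      field_simp
      ring

theorem B_eq_w {p₁ p₂ : ℕ} (h₁ : p₁ ≠ 0) (h₂ : p₂ ≠ 0) (z : ℂ) :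
    B p₁ p₂ z = w p₁ p₂ (p₁ * p₂ * z) := by
  have h₁c : (p₁ : ℂ) ≠ 0 := Nat.cast_ne_zero.2 h₁
  have h₂c : (p₂ : ℂ) ≠ 0 := Nat.cast_ne_zero.2 h₂
  have e₁ : p₁ * p₂ * z / p₁ = p₂ * z := by field_simp
  have e₂ : p₁ * p₂ * z / p₂ = p₁ * z := by field_simp
  have e₃ : p₁ * p₂ * z / (p₁ * p₂) = z := by field_simp
  rw [B, w, e₁, e₂, e₃, mul_comm (eta (p₁ * z))]

theorem isConjugate_B {p₁ p₂ : ℕ} (h₁ : p₁ ≠ 0) (h₂ : p₂ ≠ 0) :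
    IsConjugate p₁ p₂ ModularGroup.S (B p₁ p₂) (-r p₁ p₂) 1 := by
  have h₁' : (0 : ℚ) < p₁ := Nat.cast_pos.2 (Nat.pos_of_ne_zero h₁)
  have h₂' : (0 : ℚ) < p₂ := Nat.cast_pos.2 (Nat.pos_of_ne_zero h₂)
  have h₁c : (p₁ : ℂ) ≠ 0 := Nat.cast_ne_zero.2 h₁
  have h₂c : (p₂ : ℂ) ≠ 0 := Nat.cast_ne_zero.2 h₂
  refine ⟨fun z => ?_, ?_⟩
  · have hz0 := ne_zero_of_im_pos z.im_pos
    have key : ∀ q : ℕ, q ≠ 0 → eta (-1 / z / q) =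
        e24 0 * (q : ℂ).sqrt * (-I * z).sqrt * eta (q * z) := fun q hq =>
      eta_int_sub_one_div hq 0 z.im_pos (by
        have : (q : ℂ) ≠ 0 := Nat.cast_ne_zero.2 hq
        push_cast
        field_simp
        ring)
    have k₃ := key (p₁ * p₂) (mul_ne_zero h₁ h₂)
    have k₄ := key 1 one_ne_zero
    rw [Nat.cast_mul, sqrt_natCast_mul h₁ h₂c] at k₃
    rw [Nat.cast_one, div_one, one_mul, Complex.sqrt_one] at k₄
    have hs := sqrt_ne_zero (neg_I_mul_ne_zero hz0)
    rw [coe_S_smul, w, B, mul_comm (eta (z : ℂ))]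
    refine (quotient_eq (F := 1) (key p₁ h₁) (key p₂ h₂) k₃ k₄ hs hs ?_ ?_ ?_).trans (one_mul _)
    · exact mul_ne_zero (e24_ne_zero _) (mul_ne_zero (sqrt_ne_zero h₁c) (sqrt_ne_zero h₂c))
    · exact mul_ne_zero (e24_ne_zero _) one_ne_zero
    · ring
  · refine hasQLeadingTerm_eta_quotient (c := 1) (α₁ := p₁) (β₁ := 0) (α₂ := p₂)
      (β₂ := 0) (α₃ := 1) (β₃ := 0) (α₄ := p₁ * p₂) (β₄ := 0)
      one_ne_zero (by positivity) (by positivity) one_pos (by positivity) ?_ ?_ ?_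
    · intro z _
      rw [B, one_mul]
      push_cast
      simp
    · rw [r]
      ring
    · simp [zetaPow]

/-! ### Congruences modulo 24 and the constant factors. -/

lemma eight_dvd_sq_sub_one {p : ℕ} (hp : Odd p) : (8 : ℤ) ∣ (p : ℤ) ^ 2 - 1 :=
  Int.eight_dvd_sq_sub_one_of_odd (by exact_mod_cast hp)

/-- The discrepancy between the multiplier exponents and the power of `φ`. It vanishes modulo 3 even
if `p₂ = 3`: then `p₁μν ≡ -1`, so `p₁ ≡ 1` or `μ ≡ ν`. -/
lemma exponent_C_mod {p₁ p₂ : ℕ} (h₂ : Odd p₂) {μ ν v₂ : ℤ} (h : p₂ * v₂ = 1 + p₁ * μ * ν) :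
    (24 : ℤ) ∣ ((p₁ : ℤ) - 1) * (p₂ ^ 2 - 1) * v₂ * (ν - μ) := by
  refine dvd_24_of ?_ ?_
  · refine (ZMod.intCast_zmod_eq_zero_iff_dvd _ 3).1 ?_
    have h' := congrArg (Int.cast : ℤ → ZMod 3) h
    push_cast at h' ⊢
    generalize (p₁ : ZMod 3) = a, (p₂ : ZMod 3) = b, (μ : ZMod 3) = c, (ν : ZMod 3) = d,
      (v₂ : ZMod 3) = v at *
    revert a b c d v
    decide
  · exact (((eight_dvd_sq_sub_one h₂).mul_left _).mul_right _).mul_right _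

/-- The same discrepancy for `μ = 0`; for `p₂ = 3` one has `u p₁ ≡ 1`, so `p₁ ≡ 1` or `u ≡ -1`. -/
lemma exponent_C0_mod {p₁ p₂ : ℕ} (h₂ : Odd p₂) {u v : ℤ} (h : u * p₁ + v * p₂ = 1) :
    (24 : ℤ) ∣ ((p₁ : ℤ) - 1) * (p₂ ^ 2 - 1) * v * (u + 1) := by
  refine dvd_24_of ?_ ?_
  · refine (ZMod.intCast_zmod_eq_zero_iff_dvd _ 3).1 ?_
    have h' := congrArg (Int.cast : ℤ → ZMod 3) h
    push_cast at h' ⊢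
    generalize (p₁ : ZMod 3) = a, (p₂ : ZMod 3) = b, (u : ZMod 3) = c, (v : ZMod 3) = d at *
    clear h
    revert a b c d
    decide
  · exact (((eight_dvd_sq_sub_one h₂).mul_left _).mul_right _).mul_right _

/-- For `p = 3` the relation gives `μν ≡ -1`, hence `ν ≡ -μ`. -/
lemma exponent_CSq_mod {p : ℕ} (hp : Odd p) {μ ν v : ℤ} (h : 1 = -(μ * ν) + v * p) :
    (24 : ℤ) ∣ ((p : ℤ) ^ 2 - 1) * v * (ν + μ) := by
  refine dvd_24_of ?_ ?_
  · refine (ZMod.intCast_zmod_eq_zero_iff_dvd _ 3).1 ?_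
    have h' := congrArg (Int.cast : ℤ → ZMod 3) h
    push_cast at h' ⊢
    generalize (p : ZMod 3) = a, (μ : ZMod 3) = b, (ν : ZMod 3) = c, (v : ZMod 3) = d at *
    clear h
    revert a b c d
    decide
  · exact ((eight_dvd_sq_sub_one hp).mul_right _).mul_right _

lemma e24_mul_eq_of_dvd {a b c d e : ℤ} (h : (24 : ℤ) ∣ a + b - (c + (d + e))) :
    e24 a * e24 b = e24 c * (e24 d * e24 e) := by
  rw [← e24_add, ← e24_add, ← e24_add]
  exact e24_congr h

lemma factor_eq_of_odd {p₁ p₂ : ℕ} [Fact p₂.Prime] (h₂ : Odd p₂) (θ : ℤ) :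
    factor p₁ p₂ θ = e24 (((p₁ : ℤ) - 1) * ((p₂ : ℤ) - 1) * θ) * (J(p₁ | p₂) : ℂ) := by
  have : p₂ ≠ 2 := by
    rintro rfl
    exact absurd h₂ (by decide)
  rw [factor, phi_zpow, eps, if_neg this, jacobiSym.legendreSym.to_jacobiSym]

lemma factor_two {p₁ : ℕ} (θ : ℤ) :
    factor p₁ 2 θ = e24 (((p₁ : ℤ) - 1) * θ) := by
  rw [factor, phi_zpow, eps, if_pos rfl]
  norm_num

lemma factor_ne_zero {p₁ p₂ : ℕ} [Fact p₁.Prime] [Fact p₂.Prime] (h : p₁ ≠ p₂) (θ : ℤ) :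
    factor p₁ p₂ θ ≠ 0 := by
  rw [factor, phi_zpow]
  refine mul_ne_zero (e24_ne_zero _) (Int.cast_ne_zero.2 ?_)
  rw [eps]
  split_ifs with h2
  · exact one_ne_zero
  · rw [jacobiSym.legendreSym.to_jacobiSym]
    exact jacobiSym.ne_zero (by
      rw [Int.gcd_natCast_natCast]
      exact (Nat.coprime_primes Fact.out Fact.out).2 h)

lemma jacobiSym_mul_self {a : ℤ} {b : ℕ} (h : IsCoprime a b) : J(a | b) * J(a | b) = 1 := by
  rw [← sq, jacobiSym.sq_one (Int.isCoprime_iff_gcd_eq_one.1 h)]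

/-- The value of the Jacobi symbol at `2`. -/
lemma jacobiSym_two {n : ℕ} {k : ℤ} (hn : (n : ℤ) = 2 * k + 1) :
    (J(2 | n) : ℂ) = e24 (6 * (k * (k + 1))) := by
  rw [jacobiSym.at_two ⟨k.toNat, by omega⟩, ZMod.χ₈_nat_eq_if_mod_eight]
  have hk : k % 4 = 0 ∨ k % 4 = 1 ∨ k % 4 = 2 ∨ k % 4 = 3 := by omega
  have hodd : n % 2 ≠ 0 := by omega
  rw [if_neg hodd]
  obtain ⟨m, hm⟩ : ∃ m, k = 4 * m + k % 4 := ⟨k / 4, by omega⟩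
  rcases hk with h | h | h | h <;> rw [h] at hm <;> subst hm
  · rw [if_pos (by omega), Int.cast_one, ← e24_zero]
    exact e24_congr ⟨-(m * (4 * m + 1)), by ring⟩
  · rw [if_neg (by omega), Int.cast_neg, Int.cast_one, ← e24_12]
    exact e24_congr ⟨-(4 * m ^ 2 + 3 * m), by ring⟩
  · rw [if_neg (by omega), Int.cast_neg, Int.cast_one, ← e24_12]
    exact e24_congr ⟨-(4 * m ^ 2 + 5 * m + 1), by ring⟩
  · rw [if_pos (by omega), Int.cast_one, ← e24_zero]
    exact e24_congr ⟨-(4 * m ^ 2 + 7 * m + 3), by ring⟩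

/-! ### Distinct primes: the conjugates by `M_{2,μ}`, `μ > 0`. -/

section Mixed

lemma C_eq_of_quotient {p₁ p₂ : ℕ} [Fact p₂.Prime] (θ : ℤ) (ν : ℕ) {z x₁ x₂ x₃ x₄ k₁ k₂ k₃ k₄ s t : ℂ}
    (h₁ : x₁ = k₁ * s * eta (p₁ * (z + ν))) (h₂ : x₂ = k₂ * t * eta ((z + ν) / p₂))
    (h₃ : x₃ = k₃ * s * eta (p₁ * (z + ν) / p₂)) (h₄ : x₄ = k₄ * t * eta (z + ν))
    (hs : s ≠ 0) (ht : t ≠ 0) (hk₃ : k₃ ≠ 0) (hk₄ : k₄ ≠ 0)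
    (hF : k₁ * k₂ = factor p₁ p₂ θ * (k₃ * k₄)) :
    x₁ * x₂ / (x₃ * x₄) = C p₁ p₂ θ ν z := by
  rw [C, mul_comm (eta (z + ν))]
  exact quotient_eq h₁ h₂ h₃ h₄ hs ht hk₃ hk₄ hF

variable {p₁ p₂ : ℕ} [Fact p₁.Prime] [Fact p₂.Prime]

lemma hasQLeadingTerm_C (h : p₁ ≠ p₂) (θ : ℤ) (ν : ℕ) :
    HasQLeadingTerm (C p₁ p₂ θ ν) (r p₁ p₂ / p₂)
      (factor p₁ p₂ θ * zetaPow p₂ (ν * r p₁ p₂)) := by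
  have h₁ : p₁ ≠ 0 := (Fact.out : p₁.Prime).ne_zero
  have h₂ : p₂ ≠ 0 := (Fact.out : p₂.Prime).ne_zero
  have h₁' : (0 : ℚ) < p₁ := Nat.cast_pos.2 (Nat.pos_of_ne_zero h₁)
  have h₂' : (0 : ℚ) < p₂ := Nat.cast_pos.2 (Nat.pos_of_ne_zero h₂)
  refine hasQLeadingTerm_eta_quotient (α₁ := p₁) (β₁ := p₁ * ν) (α₂ := 1 / p₂)
    (β₂ := ν / p₂) (α₃ := 1) (β₃ := ν) (α₄ := p₁ / p₂) (β₄ := p₁ * ν / p₂)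
    (factor_ne_zero h θ) (by positivity) (by positivity) one_pos (by positivity) ?_ ?_ ?_
  · intro z _
    rw [C]
    push_cast
    congr 3 <;> congr 1 <;> ring
  · rw [r]
    field_simp
    ring
  · congr 1
    refine zetaPow_congr h₂ (by norm_num) ?_
    rw [r]
    push_cast
    field_simp
    ring

lemma eta_M_div_left (p₁ : ℕ) (h₁ : p₁ ≠ 0) (μ ν : ℕ) {z : ℂ} (hz : 0 < z.im) :
    eta ((μ * p₁ * z - 1) / z / p₁) =
      e24 (μ - p₁ * ν) * ((p₁ : ℂ).sqrt * (-I * z).sqrt) * eta (p₁ * (z + ν)) := by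
  have h₁c : (p₁ : ℂ) ≠ 0 := Nat.cast_ne_zero.2 h₁
  have hz0 := ne_zero_of_im_pos hz
  rw [eta_int_sub_one_div h₁ μ hz (by push_cast; field_simp),
    show (p₁ * (z + ν) : ℂ) = p₁ * z + (p₁ * ν : ℤ) by push_cast; ring, eta_add_int, e24_sub]
  have := e24_ne_zero (p₁ * ν)
  field_simp

lemma eta_M (p₁ : ℕ) (μ ν : ℕ) {z : ℂ} (hz : 0 < z.im) :
    eta ((μ * p₁ * z - 1) / z) = e24 (μ * p₁ - ν) * (-I * z).sqrt * eta (z + ν) := by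
  have hz0 := ne_zero_of_im_pos hz
  rw [eta_int_sub_one_div one_ne_zero (μ * p₁) hz (by push_cast; field_simp), Nat.cast_one,
    one_mul, Complex.sqrt_one, show (z + ν : ℂ) = z + (ν : ℤ) by push_cast; ring, eta_add_int,
    e24_sub]
  have := e24_ne_zero ν
  field_simp

lemma w_M_of_odd (h₂ : Odd p₂) (μ ν : ℕ) (v₂ : ℤ)
    (h : p₂ * v₂ = 1 + p₁ * μ * ν) {z : ℂ} (hz : 0 < z.im) :
    w p₁ p₂ ((μ * p₁ * z - 1) / z) = C p₁ p₂ (μ * ((p₂ + 1) * v₂ + 1) + ν) ν z := by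
  have h₁0 : p₁ ≠ 0 := (Fact.out : p₁.Prime).ne_zero
  have h₂0 : p₂ ≠ 0 := (Fact.out : p₂.Prime).ne_zero
  have h₁c : (p₁ : ℂ) ≠ 0 := Nat.cast_ne_zero.2 h₁0
  have h₂c : (p₂ : ℂ) ≠ 0 := Nat.cast_ne_zero.2 h₂0
  have hz0 := ne_zero_of_im_pos hz
  have hs := sqrt_ne_zero (neg_I_mul_ne_zero hz0)
  have hzν : 0 < (z + ν).im := by simpa using hz
  have hpz := natCast_mul_im_pos hzν h₁0
  have hc : (p₂ * v₂ : ℂ) = 1 + p₁ * μ * ν := by exact_mod_cast congrArg (Int.cast : ℤ → ℂ) h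
  -- The shift by `ν` is chosen so that the denominator `p₂ * y - ν` is exactly `z`, and `p₁ z` in
  -- the next formula. The determinants are 1 by the definition of `v₂`.
  have k₂ := eta_eq_of_odd_left h₂ (a := μ * p₁) (b := -v₂) (d := -ν) (by linarith)
    (x := (μ * p₁ * z - 1) / z / p₂) (y := (z + ν) / p₂) (e := z)
    (div_natCast_im_pos hzν (Nat.pos_of_ne_zero h₂0)) (by push_cast; field_simp; ring)
    (by push_cast; field_simp; linear_combination -hc)
  have k₃ := eta_eq_of_odd_left h₂ (a := μ) (b := -v₂) (d := -(ν * p₁)) (by linarith)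
    (x := (μ * p₁ * z - 1) / z / (p₁ * p₂)) (y := p₁ * (z + ν) / p₂) (e := p₁ * z)
    (div_natCast_im_pos hpz (Nat.pos_of_ne_zero h₂0)) (by push_cast; field_simp; ring)
    (by push_cast; field_simp; linear_combination -hc)
  rw [show -I * (p₁ * z) = p₁ * (-I * z) by ring,
    sqrt_natCast_mul h₁0 (neg_I_mul_ne_zero hz0)] at k₃
  have hco : IsCoprime (-(ν * p₁) : ℤ) p₂ := ⟨μ, v₂, by linarith⟩
  have hco' : IsCoprime (p₁ : ℤ) p₂ := ⟨-(μ * ν), v₂, by linarith⟩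
  rw [w]
  refine C_eq_of_quotient _ ν (eta_M_div_left p₁ h₁0 μ ν hz) k₂ k₃ (eta_M p₁ μ ν hz)
    (mul_ne_zero (sqrt_ne_zero h₁c) hs) hs
    (mul_ne_zero (Int.cast_ne_zero.2 (jacobiSym.ne_zero
      (Int.isCoprime_iff_gcd_eq_one.1 hco))) (e24_ne_zero _)) (e24_ne_zero _) ?_
  -- The two symbols differ by `J(p₁ | p₂)`, which is the source of `ε₂`.
  have hJ : J(-ν | p₂) = J(p₁ | p₂) * J(-(ν * p₁) | p₂) := by
    rw [show (-(ν * p₁) : ℤ) = p₁ * -ν by ring, jacobiSym.mul_left, ← mul_assoc,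
      jacobiSym_mul_self hco', one_mul]
  rw [factor_eq_of_odd h₂, hJ]
  have hE := e24_mul_eq_of_dvd (a := μ - p₁ * ν)
    (b := (μ * p₁ + -ν) * p₂ - -v₂ * -ν * (p₂ ^ 2 - 1) - 3 * p₂ + 3)
    (c := ((p₁ : ℤ) - 1) * ((p₂ : ℤ) - 1) * (μ * ((p₂ + 1) * v₂ + 1) + ν))
    (d := (μ + -(ν * p₁)) * p₂ - -v₂ * -(ν * p₁) * (p₂ ^ 2 - 1) - 3 * p₂ + 3)
    (e := μ * p₁ - ν) (by
      have := exponent_C_mod h₂ h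
      convert this using 1
      ring)
  push_cast
  linear_combination (J(p₁ | p₂) * J(-(ν * p₁) | p₂) : ℂ) * hE

lemma w_M_two {p₁ : ℕ} (h₁ : Odd p₁) (v₂ : ℤ)
    (h : 2 * v₂ = 1 + p₁) {z : ℂ} (hz : 0 < z.im) :
    w p₁ 2 (((1 : ℕ) * p₁ * z - 1) / z) = C p₁ 2 (3 * p₁ + 2) 1 z := by
  have h₁0 : p₁ ≠ 0 := h₁.pos.ne'
  have h₁c : (p₁ : ℂ) ≠ 0 := Nat.cast_ne_zero.2 h₁0
  have hz0 := ne_zero_of_im_pos hz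
  have hs := sqrt_ne_zero (neg_I_mul_ne_zero hz0)
  have hzν : 0 < (z + (1 : ℕ)).im := by simpa using hz
  have hpz := natCast_mul_im_pos hzν h₁0
  have hc : (2 * v₂ : ℂ) = 1 + p₁ := by exact_mod_cast congrArg (Int.cast : ℤ → ℂ) h
  have hsz : (-z).sqrt = e24 (-3) * (-I * z).sqrt := by
    rw [← sqrt_neg_I_mul (by simpa using hz), ← mul_assoc]
    simp
  -- The lower left entry is now even, so the formula for odd `d` is needed. The matrices are
  -- negated to make their lower right entries `1` and `p₁` positive.
  have k₂ := eta_eq_of_odd_right odd_one (a := -p₁) (b := v₂) (c := -2)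
    (by push_cast; linarith)
    (x := ((1 : ℕ) * p₁ * z - 1) / z / (2 : ℕ)) (y := (z + (1 : ℕ)) / (2 : ℕ)) (e := -z)
    (div_natCast_im_pos hzν two_pos) (by push_cast; field_simp; ring)
    (by push_cast; field_simp; linear_combination hc)
  have k₃ := eta_eq_of_odd_right h₁ (a := -1) (b := v₂) (c := -2) (by linarith)
    (x := ((1 : ℕ) * p₁ * z - 1) / z / (p₁ * (2 : ℕ))) (y := p₁ * (z + (1 : ℕ)) / (2 : ℕ))
    (e := p₁ * (-z))
    (div_natCast_im_pos hpz two_pos) (by push_cast; field_simp; ring)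
    (by push_cast; field_simp; linear_combination hc)
  rw [hsz, ← mul_assoc] at k₂
  rw [sqrt_natCast_mul h₁0 (neg_ne_zero.2 hz0), hsz, mul_left_comm (p₁ : ℂ).sqrt,
    ← mul_assoc (_ * e24 _)] at k₃
  rw [w]
  rw [show -(-2 : ℤ) = 2 by rfl] at k₂ k₃
  obtain ⟨k, hk⟩ := h₁
  have hk' : (p₁ : ℤ) = 2 * k + 1 := by exact_mod_cast hk
  have hv : v₂ = k + 1 := by linarith
  rw [jacobiSym_two hk'] at k₃
  refine C_eq_of_quotient _ 1 (eta_M_div_left p₁ h₁0 1 1 hz) k₂ k₃ (eta_M p₁ 1 1 hz)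
    (mul_ne_zero (sqrt_ne_zero h₁c) hs) hs
    (mul_ne_zero (mul_ne_zero (e24_ne_zero _) (e24_ne_zero _)) (e24_ne_zero _))
    (e24_ne_zero _) ?_
  rw [factor_two, jacobiSym.one_right, Int.cast_one, one_mul, ← e24_add, ← e24_add, ← e24_add,
    ← e24_add, ← e24_add, ← e24_add]
  obtain ⟨m, hm⟩ := Int.even_mul_succ_self k
  refine e24_congr ⟨-m, ?_⟩
  rw [hk', hv]
  push_cast
  linear_combination -12 * hm

end Mixed

/-! ### Distinct primes: the conjugate by `M_{2,0}`. -/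

lemma natCast_mul_add_sqrt {p : ℕ} (hp : p ≠ 0) {z : ℂ} (hz : z + 1 ≠ 0) :
    (-I * (p * (z + 1))).sqrt = (p : ℂ).sqrt * (-I * (z + 1)).sqrt := by
  rw [show -I * (p * (z + 1)) = p * (-I * (z + 1)) by ring,
    sqrt_natCast_mul hp (neg_I_mul_ne_zero hz)]

lemma eta_M0_div_left {p₁ p₂ : ℕ} (h₁ : p₁ ≠ 0) {u v : ℤ} (h : u * p₁ + v * p₂ = 1) {z : ℂ}
    (hz : 0 < z.im) : eta ((u * p₁ * z - v * p₂) / (z + 1) / p₁) =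
      e24 (u + p₁) * ((p₁ : ℂ).sqrt * (-I * (z + 1)).sqrt) * eta (p₁ * (z + (0 : ℕ))) := by
  have h₁c : (p₁ : ℂ) ≠ 0 := Nat.cast_ne_zero.2 h₁
  have hz1 : z + 1 ≠ 0 := ne_zero_of_im_pos (by simpa using hz)
  have k := eta_eq_of_odd_left odd_one (a := u) (b := -(v * p₂)) (d := p₁)
    (by push_cast; linarith)
    (x := (u * p₁ * z - v * p₂) / (z + 1) / p₁) (y := p₁ * z) (e := p₁ * (z + 1))
    (natCast_mul_im_pos hz h₁) (by push_cast; ring) (by push_cast; field_simp; ring)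
  rw [k, natCast_mul_add_sqrt h₁ hz1, jacobiSym.one_right, Nat.cast_zero, add_zero,
    Int.cast_one, one_mul]
  congr 3
  push_cast
  ring

lemma eta_M0 {p₁ p₂ : ℕ} {u v : ℤ} (h : u * p₁ + v * p₂ = 1) {z : ℂ} (hz : 0 < z.im) :
    eta ((u * p₁ * z - v * p₂) / (z + 1)) =
      e24 (u * p₁ + 1) * (-I * (z + 1)).sqrt * eta (z + (0 : ℕ)) := by
  have hz1 : z + 1 ≠ 0 := ne_zero_of_im_pos (by simpa using hz)
  have k := eta_eq_of_odd_left odd_one (a := u * p₁) (b := -(v * p₂)) (d := 1)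
    (by push_cast; linarith)
    (x := (u * p₁ * z - v * p₂) / (z + 1)) (y := z) (e := z + 1)
    hz (by push_cast; ring) (by push_cast; field_simp; ring)
  rw [k, jacobiSym.one_right, Nat.cast_zero, add_zero, Int.cast_one, one_mul]
  congr 3
  push_cast
  ring

section Mixed

variable {p₁ p₂ : ℕ} [Fact p₁.Prime] [Fact p₂.Prime]

lemma w_M0_of_odd (h₂ : Odd p₂) {u v : ℤ} (h : u * p₁ + v * p₂ = 1) {z : ℂ} (hz : 0 < z.im) :
    w p₁ p₂ ((u * p₁ * z - v * p₂) / (z + 1)) = C p₁ p₂ (u * v * (p₂ + 1) + u - 1) 0 z := by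
  have h₁0 : p₁ ≠ 0 := (Fact.out : p₁.Prime).ne_zero
  have h₂0 : p₂ ≠ 0 := (Fact.out : p₂.Prime).ne_zero
  have h₁c : (p₁ : ℂ) ≠ 0 := Nat.cast_ne_zero.2 h₁0
  have h₂c : (p₂ : ℂ) ≠ 0 := Nat.cast_ne_zero.2 h₂0
  have hz1 : z + 1 ≠ 0 := ne_zero_of_im_pos (by simpa using hz)
  have hs := sqrt_ne_zero (neg_I_mul_ne_zero hz1)
  have hpz := natCast_mul_im_pos hz h₁0
  -- Dividing `M_{2,0} z` by `p₂` or `p₁p₂` yields lower rows `(p₂, 1)` and `(p₂, p₁)`; the relation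
  -- between `u` and `v` is the determinant condition for both.
  have k₂ := eta_eq_of_odd_left h₂ (a := u * p₁) (b := -v) (d := 1) (by linarith)
    (x := (u * p₁ * z - v * p₂) / (z + 1) / p₂) (y := (z + (0 : ℕ)) / p₂) (e := z + 1)
    (div_natCast_im_pos (by simpa using hz) (Nat.pos_of_ne_zero h₂0))
    (by push_cast; field_simp; ring) (by push_cast; field_simp; ring)
  have k₃ := eta_eq_of_odd_left h₂ (a := u) (b := -v) (d := p₁) (by linarith)
    (x := (u * p₁ * z - v * p₂) / (z + 1) / (p₁ * p₂)) (y := p₁ * (z + (0 : ℕ)) / p₂)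
    (e := p₁ * (z + 1))
    (div_natCast_im_pos (by simpa using hpz) (Nat.pos_of_ne_zero h₂0))
    (by push_cast; field_simp; ring) (by push_cast; field_simp; ring)
  rw [natCast_mul_add_sqrt h₁0 hz1] at k₃
  have hco : IsCoprime (p₁ : ℤ) p₂ := ⟨u, v, h⟩
  rw [w]
  refine C_eq_of_quotient _ 0 (eta_M0_div_left h₁0 h hz) k₂ k₃ (eta_M0 h hz)
    (mul_ne_zero (sqrt_ne_zero h₁c) hs) hs
    (mul_ne_zero (Int.cast_ne_zero.2 (jacobiSym.ne_zero
      (Int.isCoprime_iff_gcd_eq_one.1 hco))) (e24_ne_zero _)) (e24_ne_zero _) ?_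
  have hJ : (J(p₁ | p₂) * J(p₁ | p₂) : ℂ) = 1 := by
    exact_mod_cast jacobiSym_mul_self hco
  rw [factor_eq_of_odd h₂, jacobiSym.one_left, Int.cast_one, one_mul]
  have hE := e24_mul_eq_of_dvd (a := u + p₁)
    (b := (u * p₁ + 1) * p₂ - -v * 1 * (p₂ ^ 2 - 1) - 3 * p₂ + 3)
    (c := ((p₁ : ℤ) - 1) * ((p₂ : ℤ) - 1) * (u * v * (p₂ + 1) + u - 1))
    (d := (u + p₁) * p₂ - -v * p₁ * (p₂ ^ 2 - 1) - 3 * p₂ + 3)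
    (e := u * p₁ + 1) (by
      obtain ⟨t, ht⟩ := exponent_C0_mod h₂ h
      exact ⟨-t, by linear_combination -ht⟩)
  rw [hE]
  linear_combination -(e24 (((p₁ : ℤ) - 1) * ((p₂ : ℤ) - 1) * (u * v * (p₂ + 1) + u - 1)) *
    (e24 ((u + p₁) * p₂ - -v * p₁ * (p₂ ^ 2 - 1) - 3 * p₂ + 3) * e24 (u * p₁ + 1))) * hJ

lemma w_M0_two {p₁ : ℕ} (h₁ : Odd p₁) {u v : ℤ} (h : u * p₁ + v * (2 : ℕ) = 1) {z : ℂ}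
    (hz : 0 < z.im) :
    w p₁ 2 ((u * p₁ * z - v * (2 : ℕ)) / (z + 1)) = C p₁ 2 ((3 * u + 2) * (u - 1) / 2) 0 z := by
  have h₁0 : p₁ ≠ 0 := h₁.pos.ne'
  have h₁c : (p₁ : ℂ) ≠ 0 := Nat.cast_ne_zero.2 h₁0
  have hz1' : 0 < (z + 1).im := by simpa using hz
  have hz1 : z + 1 ≠ 0 := ne_zero_of_im_pos hz1'
  have hs := sqrt_ne_zero (neg_I_mul_ne_zero hz1)
  have hpz := natCast_mul_im_pos hz h₁0
  have hsz : (z + 1).sqrt = e24 3 * (-I * (z + 1)).sqrt := by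
    rw [← sqrt_I_mul (by simpa using hz1'), ← mul_assoc]
    simp
  have k₂ := eta_eq_of_odd_right odd_one (a := u * p₁) (b := -v) (c := 2)
    (by push_cast at h ⊢; linarith)
    (x := (u * p₁ * z - v * (2 : ℕ)) / (z + 1) / (2 : ℕ)) (y := (z + (0 : ℕ)) / (2 : ℕ))
    (e := z + 1) (div_natCast_im_pos (by simpa using hz) two_pos)
    (by push_cast; field_simp; ring) (by push_cast; field_simp; ring)
  have k₃ := eta_eq_of_odd_right h₁ (a := u) (b := -v) (c := 2)
    (by push_cast at h; linarith)
    (x := (u * p₁ * z - v * (2 : ℕ)) / (z + 1) / (p₁ * (2 : ℕ)))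
    (y := p₁ * (z + (0 : ℕ)) / (2 : ℕ)) (e := p₁ * (z + 1))
    (div_natCast_im_pos (by simpa using hpz) two_pos)
    (by push_cast; field_simp; ring) (by push_cast; field_simp; ring)
  rw [sqrt_natCast_mul h₁0 hz1, hsz, mul_left_comm (p₁ : ℂ).sqrt, ← mul_assoc (_ * e24 _)] at k₃
  rw [hsz, ← mul_assoc] at k₂
  obtain ⟨k, hk⟩ := h₁
  have hk' : (p₁ : ℤ) = 2 * k + 1 := by exact_mod_cast hk
  -- Since `p₂ = 2`, `u p₁` is odd; writing `u` and `p₁` as odd numbers makes the division in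
  -- `θ₂(0)` exact and turns the claim into a polynomial congruence.
  obtain ⟨m, hm⟩ : ∃ m, u = 2 * m + 1 := by
    have hodd : Odd (u * p₁) := by
      rw [show u * p₁ = 2 * -v + 1 by push_cast at h; linarith]
      exact odd_two_mul_add_one _
    exact (Int.odd_mul.1 hodd).1
  have hv : v = -m - k - 2 * m * k := by
    rw [hk', hm] at h
    push_cast at h
    linarith
  rw [jacobiSym_neg_left_eq 2 hk, Int.cast_mul, Int.cast_pow, Int.cast_neg, Int.cast_one,
    ← e24_12_mul, jacobiSym_two hk'] at k₃
  rw [w]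
  refine C_eq_of_quotient _ 0 (eta_M0_div_left h₁0 h hz) k₂ k₃ (eta_M0 h hz)
    (mul_ne_zero (sqrt_ne_zero h₁c) hs) hs
    (mul_ne_zero (mul_ne_zero (mul_ne_zero (e24_ne_zero _) (e24_ne_zero _)) (e24_ne_zero _))
      (e24_ne_zero _)) (e24_ne_zero _) ?_
  have hθ : (3 * u + 2) * (u - 1) / 2 = (6 * m + 5) * m := by
    rw [hm, show (3 * (2 * m + 1) + 2) * (2 * m + 1 - 1) = 2 * ((6 * m + 5) * m) by ring,
      Int.mul_ediv_cancel_left _ two_ne_zero]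
  rw [hθ, factor_two, jacobiSym.one_right, Int.cast_one, one_mul]
  simp only [← e24_add]
  obtain ⟨t, ht⟩ := Int.even_mul_succ_self k
  obtain ⟨t', ht'⟩ := Int.even_mul_succ_self m
  refine e24_congr ⟨m * t - k * t', ?_⟩
  rw [hk', hv, hm]
  push_cast
  linear_combination 12 * m * ht - 12 * k * ht'

lemma odd_of_prime_ne_two {p : ℕ} [Fact p.Prime] (h : p ≠ 2) : Odd p :=
  (Fact.out : p.Prime).odd_of_ne_two h

theorem isConjugate_C_zero (hne : p₁ ≠ p₂) {u v : ℤ} (h : u * p₁ + v * p₂ = 1) :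
    IsConjugate p₁ p₂ (M0 p₁ p₂ u v h) (C p₁ p₂ (theta0 p₂ u v) 0) (r p₁ p₂ / p₂)
      (factor p₁ p₂ (theta0 p₂ u v)) := by
  refine ⟨fun z => ?_, ?_⟩
  · rw [coe_M0_smul, theta0]
    split_ifs with h2
    · subst h2
      exact w_M0_two (odd_of_prime_ne_two hne) h z.im_pos
    · exact w_M0_of_odd (odd_of_prime_ne_two h2) h z.im_pos
  · have := hasQLeadingTerm_C hne (theta0 p₂ u v) 0
    simpa [zetaPow] using this

theorem isConjugate_C (hne : p₁ ≠ p₂) {μ ν : ℕ} {v₂ : ℤ} (hμ : 1 ≤ μ) (hμ' : μ < p₂)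
    (hν : 1 ≤ ν) (hν' : ν < p₂) (h : p₂ * v₂ = 1 + p₁ * μ * ν) :
    IsConjugate p₁ p₂ (M p₁ μ) (C p₁ p₂ (theta p₁ p₂ μ ν v₂) ν) (r p₁ p₂ / p₂)
      (factor p₁ p₂ (theta p₁ p₂ μ ν v₂) * zetaPow p₂ (ν * r p₁ p₂)) := by
  refine ⟨fun z => ?_, hasQLeadingTerm_C hne _ ν⟩
  rw [coe_M_smul, theta]
  split_ifs with h2
  · subst h2
    obtain rfl : μ = 1 := by omega
    obtain rfl : ν = 1 := by omega
    have := w_M_two (odd_of_prime_ne_two hne) v₂ (by push_cast at h; linarith) z.im_pos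
    simpa using this
  · exact w_M_of_odd (odd_of_prime_ne_two h2) μ ν v₂ h z.im_pos

end Mixed

/-! ### Equal primes: the conjugates by `M_μ`. -/

section Square

variable {p : ℕ} [Fact p.Prime]

lemma sqrt_natCast (p : ℕ) : (p : ℂ).sqrt = (Real.sqrt p : ℂ) := by
  rw [Complex.sqrt_of_nonneg (by rw [Complex.le_def]; simp), Complex.natCast_re]

/-- The numerator is a square, but its two factors are matched with different weights: `s` contains
`√p` and `t` does not. The unmatched `√p` is absorbed in `k₂` and becomes the constant in `C_ν`. -/
lemma CSq_eq_of_quotient (θ : ℤ) (ν : ℕ) {z x₁ x₃ x₄ k₁ k₂ k₃ k₄ s t : ℂ}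
    (h₁ : x₁ = k₁ * s * eta (p * z)) (h₂ : x₁ = k₂ * t * eta (p * z))
    (h₃ : x₃ = k₃ * s * eta (z + ν / p)) (h₄ : x₄ = k₄ * t * eta z)
    (hs : s ≠ 0) (ht : t ≠ 0) (hk₃ : k₃ ≠ 0) (hk₄ : k₄ ≠ 0)
    (hF : k₁ * k₂ = (Real.sqrt p : ℂ) * (epsSq p ν : ℂ) * e24 θ * (k₃ * k₄)) :
    x₁ * x₁ / (x₃ * x₄) = CSq p θ ν z := by
  rw [CSq, mul_comm (eta z), sq, zetaPow_24]
  exact quotient_eq h₁ h₂ h₃ h₄ hs ht hk₃ hk₄ hF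

lemma epsSq_ne_zero {ν : ℕ} (hν : 1 ≤ ν) (hν' : ν < p) : epsSq p ν ≠ 0 := by
  rw [epsSq]
  split_ifs with h2
  · exact one_ne_zero
  · rw [jacobiSym.legendreSym.to_jacobiSym]
    refine jacobiSym.ne_zero ?_
    rw [Int.neg_gcd, Int.gcd_natCast_natCast]
    exact ((Nat.Prime.coprime_iff_not_dvd Fact.out).2
      (Nat.not_dvd_of_pos_of_lt (by omega) hν')).symm

lemma hasQLeadingTerm_CSq {ν : ℕ} (hν : 1 ≤ ν) (hν' : ν < p) (θ : ℤ) :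
    HasQLeadingTerm (CSq p θ ν) (((p : ℚ) - 1) / 12)
      ((Real.sqrt p : ℂ) * (epsSq p ν : ℂ) * zetaPow (24 * p) (p * θ - ν)) := by
  have hp : p ≠ 0 := (Fact.out : p.Prime).ne_zero
  have hp' : (0 : ℚ) < p := Nat.cast_pos.2 (Nat.pos_of_ne_zero hp)
  have hc : (Real.sqrt p : ℂ) ≠ 0 := by
    rw [← sqrt_natCast]
    exact sqrt_ne_zero (Nat.cast_ne_zero.2 hp)
  refine hasQLeadingTerm_eta_quotient (α₁ := p) (β₁ := 0) (α₂ := p) (β₂ := 0) (α₃ := 1)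
    (β₃ := 0) (α₄ := 1) (β₄ := ν / p)
    (mul_ne_zero (mul_ne_zero hc (Int.cast_ne_zero.2 (epsSq_ne_zero hν hν')))
      (zetaPow_24 θ ▸ e24_ne_zero θ))
    hp' hp' one_pos one_pos ?_ ?_ ?_
  · intro z _
    rw [CSq, sq]
    push_cast
    simp only [add_zero, one_mul]
  · ring
  · rw [mul_assoc _ (zetaPow 24 θ), ← zetaPow_add]
    congr 1
    refine zetaPow_congr (by positivity) (by norm_num) ?_
    push_cast
    field_simp
    ring

lemma w_M_sq_of_odd (hp : Odd p) (μ ν : ℕ) (v : ℤ) (h : 1 = -(μ * ν : ℤ) + v * p) {z : ℂ}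
    (hz : 0 < z.im) :
    w p p ((μ * p * z - 1) / z) =
      CSq p (p * ν * (1 - μ ^ 2) + (-3 * p + 2 + v) * μ - 3 + 3 * p) ν z := by
  have hp0 : p ≠ 0 := (Fact.out : p.Prime).ne_zero
  have hp2 : p ≠ 2 := by
    rintro rfl
    exact absurd hp (by decide)
  have hpc : (p : ℂ) ≠ 0 := Nat.cast_ne_zero.2 hp0
  have hz0 := ne_zero_of_im_pos hz
  have hs := sqrt_ne_zero (neg_I_mul_ne_zero hz0)
  have hc : (1 : ℂ) = -(μ * ν) + v * p := by exact_mod_cast congrArg (Int.cast : ℤ → ℂ) h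
  have k₁ := eta_int_sub_one_div hp0 μ (x := (μ * p * z - 1) / z / p) hz
    (by push_cast; field_simp)
  have k₄ := eta_int_sub_one_div one_ne_zero (μ * p) (x := (μ * p * z - 1) / z) hz
    (by push_cast; field_simp)
  rw [Nat.cast_one, Complex.sqrt_one, one_mul, mul_one] at k₄
  -- Here the argument is `z + ν/p`, so the denominator `p y - ν` reduces to `p z`.
  have k₃ := eta_eq_of_odd_left hp (a := μ) (b := -v) (d := -ν) (by linarith)
    (x := (μ * p * z - 1) / z / (p * p)) (y := z + ν / p) (e := p * z)
    (by
      rw [show (ν / p : ℂ) = ((ν / p : ℝ) : ℂ) by push_cast; rfl, Complex.add_im,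
        Complex.ofReal_im, add_zero]
      exact hz)
    (by push_cast; field_simp; ring)
    (by push_cast; field_simp; linear_combination hc)
  rw [show -I * (p * z) = p * (-I * z) by ring,
    sqrt_natCast_mul hp0 (neg_I_mul_ne_zero hz0)] at k₃
  have hco : IsCoprime (-ν : ℤ) p := ⟨μ, v, by linarith⟩
  rw [w]
  refine CSq_eq_of_quotient _ ν (k₁.trans (by rw [mul_assoc (e24 μ)])) k₁ k₃ k₄
    (mul_ne_zero (sqrt_ne_zero hpc) hs) hs
    (mul_ne_zero (Int.cast_ne_zero.2 (jacobiSym.ne_zero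
      (Int.isCoprime_iff_gcd_eq_one.1 hco))) (e24_ne_zero _)) (e24_ne_zero _) ?_
  -- The symbol arises in the denominator; as its square is 1, it may stand as `ε(ν)` in the
  -- numerator.
  have hJ : (J(-ν | p) * J(-ν | p) : ℂ) = 1 := by exact_mod_cast jacobiSym_mul_self hco
  rw [epsSq, if_neg hp2, jacobiSym.legendreSym.to_jacobiSym, ← sqrt_natCast]
  have hE := e24_mul_eq_of_dvd (a := μ) (b := μ)
    (c := p * ν * (1 - μ ^ 2) + (-3 * p + 2 + v) * μ - 3 + 3 * p)
    (d := (μ + -ν) * p - -v * -ν * (p ^ 2 - 1) - 3 * p + 3) (e := μ * p) (by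
      obtain ⟨t, ht⟩ := exponent_CSq_mod hp h
      exact ⟨t, by linear_combination ht + p * μ * h⟩)
  linear_combination (p : ℂ).sqrt * hE - (p : ℂ).sqrt *
    (e24 (p * ν * (1 - μ ^ 2) + (-3 * p + 2 + v) * μ - 3 + 3 * p) *
      (e24 ((μ + -ν) * p - -v * -ν * (p ^ 2 - 1) - 3 * p + 3) * e24 (μ * p))) * hJ

lemma w_M_sq_two {z : ℂ} (hz : 0 < z.im) :
    w 2 2 (((1 : ℕ) * (2 : ℕ) * z - 1) / z) = CSq 2 0 1 z := by
  have hz0 := ne_zero_of_im_pos hz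
  have h2 : ((2 : ℕ) : ℂ) ≠ 0 := by norm_num
  have hs := sqrt_ne_zero (neg_I_mul_ne_zero hz0)
  have hsz : (-z).sqrt = e24 (-3) * (-I * z).sqrt := by
    rw [← sqrt_neg_I_mul (by simpa using hz), ← mul_assoc]
    simp
  have k₁ := eta_int_sub_one_div two_ne_zero 1 (x := ((1 : ℕ) * (2 : ℕ) * z - 1) / z / (2 : ℕ)) hz
    (by push_cast; field_simp)
  have k₄ := eta_int_sub_one_div one_ne_zero 2 (x := ((1 : ℕ) * (2 : ℕ) * z - 1) / z) hz
    (by push_cast; field_simp)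
  rw [Nat.cast_one, Complex.sqrt_one, one_mul, mul_one] at k₄
  have k₃ := eta_eq_of_odd_right odd_one (a := -1) (b := 1) (c := -2) (by norm_num)
    (x := ((1 : ℕ) * (2 : ℕ) * z - 1) / z / ((2 : ℕ) * (2 : ℕ))) (y := z + (1 : ℕ) / (2 : ℕ))
    (e := (2 : ℕ) * -z)
    (by
      rw [show (((1 : ℕ) : ℂ) / (2 : ℕ)) = ((1 / 2 : ℝ) : ℂ) by push_cast; rfl, Complex.add_im,
        Complex.ofReal_im, add_zero]
      exact hz)
    (by push_cast; field_simp; ring)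
    (by push_cast; field_simp; ring)
  rw [sqrt_natCast_mul two_ne_zero (neg_ne_zero.2 hz0), hsz, mul_left_comm ((2 : ℕ) : ℂ).sqrt,
    ← mul_assoc (_ * e24 _), jacobiSym.one_right, Int.cast_one, one_mul] at k₃
  rw [w]
  refine CSq_eq_of_quotient 0 1 (k₁.trans (by rw [mul_assoc (e24 1)])) k₁ k₃ (by simpa using k₄)
    (mul_ne_zero (sqrt_ne_zero h2) hs) hs
    (mul_ne_zero (e24_ne_zero _) (e24_ne_zero _)) (e24_ne_zero 2) ?_
  rw [epsSq, if_pos rfl, ← sqrt_natCast, Int.cast_one, mul_one, ← mul_assoc, ← e24_add,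
    mul_comm, mul_assoc, ← e24_add, ← e24_add, ← e24_add]
  norm_num

theorem isConjugate_CSq {μ ν : ℕ} {v : ℤ} (hμ : 1 ≤ μ) (hμ' : μ < p)
    (hν : 1 ≤ ν) (hν' : ν < p) (h : 1 = -(μ * ν : ℤ) + v * p) :
    IsConjugate p p (M p μ) (CSq p (thetaSq p μ ν v) ν) (((p : ℚ) - 1) / 12)
      ((Real.sqrt p : ℂ) * (epsSq p ν : ℂ) * zetaPow (24 * p) (p * thetaSq p μ ν v - ν)) := by
  refine ⟨fun z => ?_, hasQLeadingTerm_CSq hν hν' _⟩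
  rw [coe_M_smul, thetaSq]
  split_ifs with h2
  · subst h2
    obtain rfl : μ = 1 := by omega
    obtain rfl : ν = 1 := by omega
    exact w_M_sq_two z.im_pos
  · exact w_M_sq_of_odd (odd_of_prime_ne_two h2) μ ν v h z.im_pos

end Square

/-! Coset representatives. -/

lemma mul_inv_mem_GammaUpper0_iff {N : ℕ} (g h : SL(2, ℤ)) :
    g * h⁻¹ ∈ GammaUpper0 N ↔ (N : ℤ) ∣ g 0 1 * h 0 0 - g 0 0 * h 0 1 := by
  change (N : ℤ) ∣ (g * h⁻¹) 0 1 ↔ _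
  simp only [Matrix.SpecialLinearGroup.coe_mul, Matrix.SpecialLinearGroup.coe_inv,
    Matrix.adjugate_fin_two, Matrix.mul_apply, Fin.sum_univ_two, Matrix.of_apply,
    Matrix.cons_val', Matrix.cons_val_zero, Matrix.cons_val_one, Matrix.cons_val_fin_one]
  rw [show g 0 0 * -h 0 1 + g 0 1 * h 0 0 = g 0 1 * h 0 0 - g 0 0 * h 0 1 by ring]

/-- Two matrices lie in the same coset exactly when their top rows are proportional modulo `N`, so
it is enough to represent each coprime top row `(a, b)` once. -/
lemma isCosetSystem_of {N : ℕ} {R : Set SL(2, ℤ)}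
    (h : ∀ a b : ℤ, IsCoprime a b →
      ∃! g : SL(2, ℤ), g ∈ R ∧ (N : ℤ) ∣ b * g 0 0 - a * g 0 1) :
    IsCosetSystem N R := by
  rw [IsCosetSystem, Subgroup.isComplement_iff_existsUnique_mul_inv_mem]
  intro g
  have hco : IsCoprime (g 0 0) (g 0 1) := by
    have hdet := g.det_coe
    rw [Matrix.det_fin_two] at hdet
    exact ⟨g 1 1, -g 1 0, by linarith⟩
  obtain ⟨t, ⟨htR, ht⟩, huniq⟩ := h _ _ hco
  refine ⟨⟨t, htR⟩, (mul_inv_mem_GammaUpper0_iff g t).2 ht, ?_⟩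
  rintro ⟨t', ht'R⟩ ht'
  exact Subtype.ext (huniq t' ⟨ht'R, (mul_inv_mem_GammaUpper0_iff g t').1 ht'⟩)

lemma coe_T_pow (ν : ℕ) :
    ((ModularGroup.T ^ ν : SL(2, ℤ)) : Matrix (Fin 2) (Fin 2) ℤ) = !![1, (ν : ℤ); 0, 1] := by
  rw [← zpow_natCast, ModularGroup.coe_T_zpow]

lemma cond_T (N a b : ℤ) (ν : ℕ) : N ∣ b * (ModularGroup.T ^ ν : SL(2, ℤ)) 0 0 -
    a * (ModularGroup.T ^ ν : SL(2, ℤ)) 0 1 ↔ N ∣ b - a * ν := by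
  rw [coe_T_pow]
  simp

lemma cond_S (N a b : ℤ) : N ∣ b * ModularGroup.S 0 0 - a * ModularGroup.S 0 1 ↔ N ∣ a := by
  simp [ModularGroup.S]

lemma cond_M (N a b : ℤ) (p : ℕ) (μ : ℤ) :
    N ∣ b * M p μ 0 0 - a * M p μ 0 1 ↔ N ∣ b * (μ * p) + a := by
  simp [M]

lemma cond_M0 (N a b : ℤ) (p₁ p₂ : ℕ) (u v : ℤ) (h : u * p₁ + v * p₂ = 1) :
    N ∣ b * M0 p₁ p₂ u v h 0 0 - a * M0 p₁ p₂ u v h 0 1 ↔ N ∣ b * (u * p₁) + a * (v * p₂) := by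
  simp [M0]

lemma exists_lt_dvd {n : ℕ} (hn : 0 < n) {a : ℤ} (ha : IsCoprime a n) (b : ℤ) :
    ∃ ν : ℕ, ν < n ∧ (n : ℤ) ∣ b - a * ν := by
  obtain ⟨x, y, hxy⟩ := ha
  have hn' : (0 : ℤ) < n := by exact_mod_cast hn
  have h0 := Int.emod_nonneg (b * x) hn'.ne'
  -- `x` is an inverse of `a` modulo `n`, so the solution is the residue of `b x`.
  refine ⟨(b * x % n).toNat, by have := Int.emod_lt_of_pos (b * x) hn'; omega, ?_⟩
  rw [Int.toNat_of_nonneg h0]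
  have h1 := Int.emod_add_mul_ediv (b * x) n
  exact ⟨b * y + a * (b * x / n), by linear_combination -b * hxy - a * h1⟩

lemma eq_of_dvd_of_lt {n : ℕ} {a : ℤ} (ha : IsCoprime a n) {b : ℤ} {ν ν' : ℕ} (hν : ν < n)
    (hν' : ν' < n) (h : (n : ℤ) ∣ b - a * ν) (h' : (n : ℤ) ∣ b - a * ν') : ν = ν' := by
  have h2 : (n : ℤ) ∣ a * ((ν : ℤ) - ν') := by
    have := dvd_sub h' h
    rwa [show b - a * (ν' : ℤ) - (b - a * ν) = a * ((ν : ℤ) - ν') by ring] at this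
  have h3 := Int.eq_zero_of_abs_lt_dvd (ha.symm.dvd_of_dvd_mul_left h2)
    (by rw [abs_lt]; constructor <;> omega)
  omega

/-! ### Linear congruences modulo a prime. -/

section Prime

variable {p : ℕ} [hp : Fact p.Prime]

lemma isCoprime_iff_not_dvd {a : ℤ} : IsCoprime a p ↔ ¬ (p : ℤ) ∣ a := by
  rw [isCoprime_comm, Prime.coprime_iff_not_dvd (Nat.prime_iff_prime_int.1 hp.out)]

lemma not_dvd_of_isCoprime {a b : ℤ} (h : IsCoprime a b) (ha : (p : ℤ) ∣ a) : ¬ (p : ℤ) ∣ b :=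
  fun hb => (Nat.prime_iff_prime_int.1 hp.out).not_isUnit (h.isUnit_of_dvd' ha hb)

lemma not_dvd_natCast {p μ : ℕ} (h : 1 ≤ μ) (h' : μ < p) : ¬ (p : ℤ) ∣ μ := by
  rw [Int.natCast_dvd_natCast]
  exact Nat.not_dvd_of_pos_of_lt (by omega) h'

lemma dvd_or_dvd' {a b : ℤ} (h : (p : ℤ) ∣ a * b) : (p : ℤ) ∣ a ∨ (p : ℤ) ∣ b :=
  (Nat.prime_iff_prime_int.1 hp.out).dvd_or_dvd h

/-- Solvability of `b + a μ ≡ 0` with `0 < μ < p`. -/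
lemma exists_pos_lt_dvd {a b : ℤ} (ha : ¬ (p : ℤ) ∣ a) (hb : ¬ (p : ℤ) ∣ b) :
    ∃ μ : ℕ, 1 ≤ μ ∧ μ < p ∧ (p : ℤ) ∣ b + a * μ := by
  obtain ⟨μ, hμ, h⟩ := exists_lt_dvd hp.out.pos (isCoprime_iff_not_dvd.2 ha).neg_left b
  rw [neg_mul, sub_neg_eq_add] at h
  refine ⟨μ, Nat.one_le_iff_ne_zero.2 ?_, hμ, h⟩
  rintro rfl
  exact hb (by simpa using h)

lemma eq_of_dvd_add {a b : ℤ} (ha : ¬ (p : ℤ) ∣ a) {μ μ' : ℕ} (hμ : μ < p) (hμ' : μ' < p)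
    (h : (p : ℤ) ∣ b + a * μ) (h' : (p : ℤ) ∣ b + a * μ') : μ = μ' :=
  eq_of_dvd_of_lt (isCoprime_iff_not_dvd.2 ha).neg_left hμ hμ'
    (b := b) (by rwa [neg_mul, sub_neg_eq_add]) (by rwa [neg_mul, sub_neg_eq_add])

lemma existsUnique_mu {k : ℕ} (hk : ¬ (p : ℤ) ∣ k) {ν : ℕ} (hν : 1 ≤ ν) (hν' : ν < p) :
    ∃! μ : ℕ, 1 ≤ μ ∧ μ < p ∧ p ∣ 1 + k * μ * ν := by
  have ha : ¬ (p : ℤ) ∣ k * ν := fun h => (dvd_or_dvd' h).elim hk (not_dvd_natCast hν hν')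
  have h1 : ¬ (p : ℤ) ∣ 1 := fun h =>
    (Nat.prime_iff_prime_int.1 hp.out).not_isUnit (isUnit_of_dvd_one h)
  have hiff : ∀ μ : ℕ, p ∣ 1 + k * μ * ν ↔ (p : ℤ) ∣ 1 + (k * ν : ℤ) * μ := by
    intro μ
    rw [← Int.natCast_dvd_natCast]
    push_cast
    rw [mul_right_comm]
  obtain ⟨μ, hμ, hμ', h⟩ := exists_pos_lt_dvd ha h1
  refine ⟨μ, ⟨hμ, hμ', (hiff μ).2 h⟩, ?_⟩
  rintro μ' ⟨-, hlt, h'⟩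
  exact eq_of_dvd_add ha hlt hμ' ((hiff μ').1 h') h

end Prime

/-! ### Cosets for distinct primes. -/

section Mixed

variable {p₁ p₂ : ℕ} [hp₁ : Fact p₁.Prime] [hp₂ : Fact p₂.Prime]

lemma not_dvd_of_ne (hne : p₁ ≠ p₂) : ¬ (p₁ : ℤ) ∣ p₂ := by
  rw [Int.natCast_dvd_natCast, Nat.prime_dvd_prime_iff_eq hp₁.out hp₂.out]
  exact hne

lemma mul_dvd_of_ne (hne : p₁ ≠ p₂) {x : ℤ} (h₁ : (p₁ : ℤ) ∣ x) (h₂ : (p₂ : ℤ) ∣ x) :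
    ((p₁ * p₂ : ℕ) : ℤ) ∣ x := by
  rw [Nat.cast_mul]
  exact (isCoprime_iff_not_dvd.2 (fun h => not_dvd_of_ne hne.symm h)).mul_dvd h₁ h₂

lemma mul_dvd_iff (hne : p₁ ≠ p₂) {x : ℤ} :
    ((p₁ * p₂ : ℕ) : ℤ) ∣ x ↔ (p₁ : ℤ) ∣ x ∧ (p₂ : ℤ) ∣ x :=
  ⟨fun h => by
    rw [Nat.cast_mul] at h
    exact ⟨(dvd_mul_right _ _).trans h, (dvd_mul_left _ _).trans h⟩,
    fun h => mul_dvd_of_ne hne h.1 h.2⟩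

lemma cond_M_iff (hne : p₁ ≠ p₂) {a b : ℤ} {μ : ℕ} :
    ((p₁ * p₂ : ℕ) : ℤ) ∣ b * (μ * p₁) + a ↔
      (p₁ : ℤ) ∣ a ∧ (p₂ : ℤ) ∣ a + b * p₁ * μ := by
  rw [mul_dvd_iff hne]
  refine and_congr ?_ ?_
  · rw [show b * (μ * p₁) + a = p₁ * (b * μ) + a by ring]
    exact Int.dvd_add_right (dvd_mul_right _ _)
  · rw [show b * (μ * p₁) + a = a + b * p₁ * μ by ring]

lemma cond_M0_iff (hne : p₁ ≠ p₂) {u v : ℤ} (h : u * p₁ + v * p₂ = 1) {a b : ℤ} :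
    ((p₁ * p₂ : ℕ) : ℤ) ∣ b * (u * p₁) + a * (v * p₂) ↔ (p₁ : ℤ) ∣ a ∧ (p₂ : ℤ) ∣ b := by
  rw [mul_dvd_iff hne]
  refine and_congr ?_ ?_
  · rw [show b * (u * p₁) + a * (v * p₂) = p₁ * ((b - a) * u) + a by linear_combination a * h]
    exact Int.dvd_add_right (dvd_mul_right _ _)
  · rw [show b * (u * p₁) + a * (v * p₂) = p₂ * ((a - b) * v) + b by linear_combination b * h]
    exact Int.dvd_add_right (dvd_mul_right _ _)

/-- The representatives `M_{2,μ}` account for the pairs `(a, b)` with `p₁ ∣ a`, `p₂ ∤ a`. -/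
lemma mixedReps_existsUnique (hne : p₁ ≠ p₂) {u v : ℤ} (h : u * p₁ + v * p₂ = 1) {a b : ℤ}
    (h₁ : (p₁ : ℤ) ∣ a) (h₂ : ¬ (p₂ : ℤ) ∣ a) :
    ∃! g : SL(2, ℤ), g ∈ mixedReps p₁ p₂ u v h ∧
      ((p₁ * p₂ : ℕ) : ℤ) ∣ b * g 0 0 - a * g 0 1 := by
  by_cases hb : (p₂ : ℤ) ∣ b
  · refine ⟨M0 p₁ p₂ u v h, ⟨Or.inl rfl, ?_⟩, ?_⟩
    · rw [cond_M0, cond_M0_iff hne h]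
      exact ⟨h₁, hb⟩
    · rintro g ⟨rfl | ⟨μ, hμ, hμ', rfl⟩, hg⟩
      · rfl
      · rw [cond_M, cond_M_iff hne] at hg
        exact absurd ((Int.dvd_add_left ((hb.mul_right _).mul_right _)).1 hg.2) h₂
  · have hb' : ¬ (p₂ : ℤ) ∣ b * p₁ := fun hd =>
      (dvd_or_dvd' hd).elim hb (not_dvd_of_ne hne.symm)
    obtain ⟨μ, hμ, hμ', hd⟩ := exists_pos_lt_dvd hb' h₂
    refine ⟨M p₁ μ, ⟨Or.inr ⟨μ, hμ, hμ', rfl⟩, ?_⟩, ?_⟩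
    · rw [cond_M, cond_M_iff hne]
      exact ⟨h₁, hd⟩
    · rintro g ⟨rfl | ⟨μ', h1, h2, rfl⟩, hg⟩
      · rw [cond_M0, cond_M0_iff hne h] at hg
        exact absurd hg.2 hb
      · rw [cond_M, cond_M_iff hne] at hg
        rw [eq_of_dvd_add hb' h2 hμ' hg.2 hd]

/-- Ensures that the families do not compete: the divisibility pattern of `a` determines which
family can represent `(a, b)`. -/
lemma dvd_of_mem_mixedReps (hne : p₁ ≠ p₂) {u v : ℤ} (h : u * p₁ + v * p₂ = 1) {a b : ℤ}
    (hab : IsCoprime a b) {g : SL(2, ℤ)} (hg : g ∈ mixedReps p₁ p₂ u v h)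
    (hd : ((p₁ * p₂ : ℕ) : ℤ) ∣ b * g 0 0 - a * g 0 1) :
    (p₁ : ℤ) ∣ a ∧ ¬ (p₂ : ℤ) ∣ a := by
  obtain rfl | ⟨μ, hμ, hμ', rfl⟩ := hg
  · rw [cond_M0, cond_M0_iff hne h] at hd
    exact ⟨hd.1, not_dvd_of_isCoprime hab.symm hd.2⟩
  · rw [cond_M, cond_M_iff hne] at hd
    refine ⟨hd.1, fun ha => ?_⟩
    have h3 := (Int.dvd_add_right ha).1 hd.2
    rcases dvd_or_dvd' h3 with h4 | h4
    · exact (dvd_or_dvd' h4).elim (not_dvd_of_isCoprime hab ha) (not_dvd_of_ne hne.symm)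
    · exact not_dvd_natCast hμ hμ' h4

end Mixed

lemma T_pow_existsUnique {N : ℕ} (hN : 0 < N) {a b : ℤ} (ha : IsCoprime a N) :
    ∃ ν < N, ((N : ℤ) ∣ b - a * ν) ∧ ∀ ν' < N, (N : ℤ) ∣ b - a * ν' → ν' = ν := by
  obtain ⟨ν, hν, h⟩ := exists_lt_dvd hN ha b
  exact ⟨ν, hν, h, fun ν' hν' h' => eq_of_dvd_of_lt ha hν' hν h' h⟩

/-- If `p` divided `a`, then `b ≡ aν` would force `p ∣ b`, against coprimality; so powers of `T`
represent only pairs with `a` a unit modulo `N`. -/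
lemma not_dvd_of_cond_T {N p : ℕ} [Fact p.Prime] (hpN : p ∣ N) {a b : ℤ} (hab : IsCoprime a b)
    {ν : ℕ} (h : (N : ℤ) ∣ b - a * ν) : ¬ (p : ℤ) ∣ a := fun ha =>
  not_dvd_of_isCoprime hab ha
    ((Int.dvd_iff_dvd_of_dvd_sub ((Int.natCast_dvd_natCast.2 hpN).trans h)).2 (ha.mul_right _))

theorem isCosetSystem_mixed {p₁ p₂ : ℕ} [Fact p₁.Prime] [Fact p₂.Prime] (hne : p₁ ≠ p₂)
    {u v : ℤ} (h : u * p₁ + v * p₂ = 1) (h' : v * p₂ + u * p₁ = 1) :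
    IsCosetSystem (p₁ * p₂)
      (commonReps (p₁ * p₂) ∪ mixedReps p₂ p₁ v u h' ∪ mixedReps p₁ p₂ u v h) := by
  refine isCosetSystem_of fun a b hab => ?_
  have hN : 0 < p₁ * p₂ := Nat.mul_pos (Fact.out : p₁.Prime).pos (Fact.out : p₂.Prime).pos
  have hT₁ : ∀ ν : ℕ, ((p₁ * p₂ : ℕ) : ℤ) ∣ b - a * ν → ¬ (p₁ : ℤ) ∣ a := fun ν hd =>
    not_dvd_of_cond_T (dvd_mul_right _ _) hab hd
  have hT₂ : ∀ ν : ℕ, ((p₁ * p₂ : ℕ) : ℤ) ∣ b - a * ν → ¬ (p₂ : ℤ) ∣ a := fun ν hd =>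
    not_dvd_of_cond_T (dvd_mul_left _ _) hab hd
  have hM₂ : ∀ g ∈ mixedReps p₁ p₂ u v h, ((p₁ * p₂ : ℕ) : ℤ) ∣ b * g 0 0 - a * g 0 1 →
    (p₁ : ℤ) ∣ a ∧ ¬ (p₂ : ℤ) ∣ a := fun g hg hd => dvd_of_mem_mixedReps hne h hab hg hd
  have hM₁ : ∀ g ∈ mixedReps p₂ p₁ v u h', ((p₁ * p₂ : ℕ) : ℤ) ∣ b * g 0 0 - a * g 0 1 →
    (p₂ : ℤ) ∣ a ∧ ¬ (p₁ : ℤ) ∣ a := fun g hg hd =>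
      dvd_of_mem_mixedReps hne.symm h' hab hg (by rwa [mul_comm p₂ p₁])
  by_cases ha₁ : (p₁ : ℤ) ∣ a <;> by_cases ha₂ : (p₂ : ℤ) ∣ a
  · refine ⟨ModularGroup.S, ⟨Or.inl (Or.inl (Or.inr rfl)), ?_⟩, ?_⟩
    · rw [cond_S]
      exact mul_dvd_of_ne hne ha₁ ha₂
    · rintro g ⟨((⟨ν, hν, rfl⟩ | rfl) | hg) | hg, hd⟩
      · rw [cond_T] at hd
        exact absurd ha₁ (hT₁ ν hd)
      · rfl
      · exact absurd ha₁ (hM₁ g hg hd).2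
      · exact absurd ha₂ (hM₂ g hg hd).2
  · obtain ⟨t, ⟨ht, htd⟩, huniq⟩ := mixedReps_existsUnique hne h ha₁ ha₂
    refine ⟨t, ⟨Or.inr ht, htd⟩, ?_⟩
    rintro g ⟨((⟨ν, hν, rfl⟩ | rfl) | hg) | hg, hd⟩
    · rw [cond_T] at hd
      exact absurd ha₁ (hT₁ ν hd)
    · rw [cond_S, mul_dvd_iff hne] at hd
      exact absurd hd.2 ha₂
    · exact absurd (hM₁ g hg hd).1 ha₂
    · exact huniq g ⟨hg, hd⟩
  · obtain ⟨t, ⟨ht, htd⟩, huniq⟩ := mixedReps_existsUnique hne.symm h' ha₂ ha₁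
    rw [mul_comm p₂ p₁] at htd huniq
    refine ⟨t, ⟨Or.inl (Or.inr ht), htd⟩, ?_⟩
    rintro g ⟨((⟨ν, hν, rfl⟩ | rfl) | hg) | hg, hd⟩
    · rw [cond_T] at hd
      exact absurd ha₂ (hT₂ ν hd)
    · rw [cond_S, mul_dvd_iff hne] at hd
      exact absurd hd.1 ha₁
    · exact huniq g ⟨hg, hd⟩
    · exact absurd (hM₂ g hg hd).1 ha₁
  · have hco : IsCoprime a ((p₁ * p₂ : ℕ) : ℤ) := by
      rw [Nat.cast_mul]
      exact (isCoprime_iff_not_dvd.2 ha₁).mul_right (isCoprime_iff_not_dvd.2 ha₂)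
    obtain ⟨ν, hν, hd, huniq⟩ := T_pow_existsUnique hN (b := b) hco
    refine ⟨ModularGroup.T ^ ν, ⟨Or.inl (Or.inl (Or.inl ⟨ν, hν, rfl⟩)), (cond_T _ _ _ _).2 hd⟩, ?_⟩
    rintro g ⟨((⟨ν', hν', rfl⟩ | rfl) | hg) | hg, hd'⟩
    · rw [cond_T] at hd'
      rw [huniq ν' hν' hd']
    · rw [cond_S, mul_dvd_iff hne] at hd'
      exact absurd hd'.1 ha₁
    · exact absurd (hM₁ g hg hd').1 ha₂
    · exact absurd (hM₂ g hg hd').1 ha₁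

/-- When `p ∣ a`, write `a = p a'`: `S` handles `p ∣ a'`, and otherwise `μ` solves `a' + bμ ≡ 0`
modulo `p`, where `b` is a unit. -/
theorem isCosetSystem_square {p : ℕ} [Fact p.Prime] :
    IsCosetSystem (p * p) (commonReps (p * p) ∪ squareReps p) := by
  have hp0 : (p : ℤ) ≠ 0 := Nat.cast_ne_zero.2 (Fact.out : p.Prime).ne_zero
  refine isCosetSystem_of fun a b hab => ?_
  have hN : 0 < p * p := Nat.mul_pos (Fact.out : p.Prime).pos (Fact.out : p.Prime).pos
  have hT : ∀ ν : ℕ, ((p * p : ℕ) : ℤ) ∣ b - a * ν → ¬ (p : ℤ) ∣ a := fun ν hd =>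
    not_dvd_of_cond_T (dvd_mul_right _ _) hab hd
  have hM : ∀ μ : ℕ, ((p * p : ℕ) : ℤ) ∣ b * (μ * p) + a →
      ∃ a', a = p * a' ∧ (p : ℤ) ∣ a' + b * μ := by
    intro μ hd
    rw [Nat.cast_mul] at hd
    have h1 : (p : ℤ) ∣ a := (Int.dvd_add_right ((dvd_mul_left (p : ℤ) μ).mul_left b)).1
      ((dvd_mul_right _ _).trans hd)
    obtain ⟨a', rfl⟩ := h1
    refine ⟨a', rfl, ?_⟩
    rw [show b * (μ * p) + p * a' = p * (a' + b * μ) by ring] at hd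
    exact (mul_dvd_mul_iff_left hp0).1 hd
  by_cases ha : (p : ℤ) ∣ a
  · have hb := not_dvd_of_isCoprime hab ha
    obtain ⟨a', rfl⟩ := ha
    have hS : ((p * p : ℕ) : ℤ) ∣ p * a' ↔ (p : ℤ) ∣ a' := by
      rw [Nat.cast_mul, mul_dvd_mul_iff_left hp0]
    have hM' : ∀ μ : ℕ, ((p * p : ℕ) : ℤ) ∣ b * (μ * p) + p * a' → (p : ℤ) ∣ a' + b * μ := by
      intro μ hd
      obtain ⟨x, hx, hd'⟩ := hM μ hd
      rwa [mul_left_cancel₀ hp0 hx]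
    by_cases ha' : (p : ℤ) ∣ a'
    · refine ⟨ModularGroup.S, ⟨Or.inl (Or.inr rfl), ?_⟩, ?_⟩
      · rw [cond_S, hS]
        exact ha'
      · rintro g ⟨(⟨ν, hν, rfl⟩ | rfl) | ⟨μ, hμ, hμ', rfl⟩, hd⟩
        · rw [cond_T] at hd
          exact absurd (dvd_mul_right _ _) (hT ν hd)
        · rfl
        · rw [cond_M] at hd
          have h3 := (Int.dvd_add_right ha').1 (hM' μ hd)
          exact ((dvd_or_dvd' h3).elim hb (not_dvd_natCast hμ hμ')).elim
    · obtain ⟨μ, hμ, hμ', hd⟩ := exists_pos_lt_dvd hb ha'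
      refine ⟨M p μ, ⟨Or.inr ⟨μ, hμ, hμ', rfl⟩, ?_⟩, ?_⟩
      · rw [cond_M, show b * (μ * p) + p * a' = p * (a' + b * μ) by ring, Nat.cast_mul]
        exact mul_dvd_mul_left _ hd
      · rintro g ⟨(⟨ν, hν, rfl⟩ | rfl) | ⟨μ', h1, h2, rfl⟩, hd'⟩
        · rw [cond_T] at hd'
          exact absurd (dvd_mul_right _ _) (hT ν hd')
        · rw [cond_S, hS] at hd'
          exact absurd hd' ha'
        · rw [cond_M] at hd'
          rw [eq_of_dvd_add hb h2 hμ' (hM' μ' hd') hd]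
  · have hco : IsCoprime a ((p * p : ℕ) : ℤ) := by
      rw [Nat.cast_mul]
      exact (isCoprime_iff_not_dvd.2 ha).mul_right (isCoprime_iff_not_dvd.2 ha)
    obtain ⟨ν, hν, hd, huniq⟩ := T_pow_existsUnique hN (b := b) hco
    refine ⟨ModularGroup.T ^ ν, ⟨Or.inl (Or.inl ⟨ν, hν, rfl⟩), (cond_T _ _ _ _).2 hd⟩, ?_⟩
    rintro g ⟨(⟨ν', hν', rfl⟩ | rfl) | ⟨μ, hμ, hμ', rfl⟩, hd'⟩
    · rw [cond_T] at hd'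
      rw [huniq ν' hν' hd']
    · rw [cond_S, Nat.cast_mul] at hd'
      exact absurd ((dvd_mul_right _ _).trans hd') ha
    · rw [cond_M] at hd'
      obtain ⟨x, rfl, -⟩ := hM μ hd'
      exact absurd (dvd_mul_right _ _) ha

/-! The number of representatives. -/

lemma finite_ncard_setOf_exists {α : Type*} {f : ℕ → α} {m n : ℕ}
    (hf : ∀ i < n, ∀ j < n, f i = f j → i = j) :
    {g | ∃ μ : ℕ, m ≤ μ ∧ μ < n ∧ g = f μ}.Finite ∧
      {g | ∃ μ : ℕ, m ≤ μ ∧ μ < n ∧ g = f μ}.ncard = n - m := by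
  have h : {g | ∃ μ : ℕ, m ≤ μ ∧ μ < n ∧ g = f μ} = f '' (Finset.Ico m n : Set ℕ) := by
    ext g
    simp only [Set.mem_ofPred_eq, Set.mem_image, Finset.coe_Ico, Set.mem_Ico]
    exact ⟨fun ⟨μ, h1, h2, h3⟩ => ⟨μ, ⟨h1, h2⟩, h3.symm⟩,
      fun ⟨μ, ⟨h1, h2⟩, h3⟩ => ⟨μ, h1, h2, h3.symm⟩⟩
  rw [h]
  refine ⟨(Finset.finite_toSet _).image f, ?_⟩
  rw [Set.InjOn.ncard_image, Set.ncard_coe_finset, Nat.card_Ico]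
  intro i hi j hj hij
  simp only [Finset.coe_Ico, Set.mem_Ico] at hi hj
  exact hf i hi.2 j hj.2 hij

lemma T_pow_injective {i j : ℕ} (h : (ModularGroup.T ^ i : SL(2, ℤ)) = ModularGroup.T ^ j) :
    i = j := by
  have h1 := congrArg (fun g : SL(2, ℤ) => g 0 1) h
  simp only [coe_T_pow] at h1
  simpa using h1

lemma M_injective {p : ℕ} (hp : p ≠ 0) {i j : ℤ} (h : M p i = M p j) : i = j := by
  have h1 := congrArg (fun g : SL(2, ℤ) => g 0 0) h
  simpa [M, hp] using h1

lemma finite_ncard_commonReps (N : ℕ) :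
    (commonReps N).Finite ∧ (commonReps N).ncard = N + 1 := by
  obtain ⟨hfin, hcard⟩ := finite_ncard_setOf_exists (m := 0) (n := N)
    (f := fun ν => (ModularGroup.T ^ ν : SL(2, ℤ))) (fun i _ j _ h => T_pow_injective h)
  simp only [Nat.zero_le, true_and, Nat.sub_zero] at hfin hcard
  refine ⟨hfin.union (Set.finite_singleton _), ?_⟩
  rw [commonReps, Set.ncard_union_eq _ hfin (Set.finite_singleton _), hcard, Set.ncard_singleton]
  rw [Set.disjoint_singleton_right]
  rintro ⟨ν, -, h⟩
  have h1 := congrArg (fun g : SL(2, ℤ) => g 0 0) h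
  simp only [coe_T_pow] at h1
  simp [ModularGroup.S] at h1

lemma finite_ncard_squareReps {p : ℕ} (hp : p ≠ 0) (n : ℕ) :
    {g | ∃ μ : ℕ, 1 ≤ μ ∧ μ < n ∧ g = M p μ}.Finite ∧
      {g | ∃ μ : ℕ, 1 ≤ μ ∧ μ < n ∧ g = M p μ}.ncard = n - 1 :=
  finite_ncard_setOf_exists fun i _ j _ h => by exact_mod_cast M_injective hp h

lemma finite_ncard_mixedReps {p₁ p₂ : ℕ} (h₁ : p₁ ≠ 0) (h₂ : p₂ ≠ 0) {u v : ℤ}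
    (h : u * p₁ + v * p₂ = 1) :
    (mixedReps p₁ p₂ u v h).Finite ∧ (mixedReps p₁ p₂ u v h).ncard = p₂ := by
  obtain ⟨hfin, hcard⟩ := finite_ncard_squareReps h₁ p₂
  refine ⟨(Set.finite_singleton _).union hfin, ?_⟩
  rw [mixedReps, Set.ncard_union_eq _ (Set.finite_singleton _) hfin, hcard, Set.ncard_singleton]
  · omega
  rw [Set.disjoint_singleton_left]
  rintro ⟨μ, -, -, h⟩
  have h1 := congrArg (fun g : SL(2, ℤ) => g 1 1) h
  simp [M, M0] at h1

lemma disjoint_commonReps_M (N : ℕ) {p n : ℕ} (hp : p ≠ 0) :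
    Disjoint (commonReps N) {g | ∃ μ : ℕ, 1 ≤ μ ∧ μ < n ∧ g = M p μ} := by
  rw [Set.disjoint_left]
  rintro g (⟨ν, -, rfl⟩ | rfl) ⟨μ, hμ, -, h⟩
  · have h1 := congrArg (fun g : SL(2, ℤ) => g 1 1) h
    simp only [coe_T_pow] at h1
    simp [M] at h1
  · have h1 := congrArg (fun g : SL(2, ℤ) => g 0 0) h
    simp [M, ModularGroup.S, hp] at h1
    omega

lemma disjoint_commonReps_mixedReps (N : ℕ) {p₁ p₂ : ℕ} (h₁ : p₁ ≠ 0) {u v : ℤ}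
    (h : u * p₁ + v * p₂ = 1) : Disjoint (commonReps N) (mixedReps p₁ p₂ u v h) := by
  rw [mixedReps, Set.disjoint_union_right]
  refine ⟨?_, disjoint_commonReps_M N h₁⟩
  rw [Set.disjoint_singleton_right]
  rintro (⟨ν, -, hν⟩ | hS)
  · have h1 := congrArg (fun g : SL(2, ℤ) => g 1 0) hν
    simp only [coe_T_pow] at h1
    simp [M0] at h1
  · have h1 := congrArg (fun g : SL(2, ℤ) => g 1 1) hS
    simp [M0, ModularGroup.S] at h1

lemma disjoint_mixedReps {p₁ p₂ : ℕ} [Fact p₁.Prime] [Fact p₂.Prime] (hne : p₁ ≠ p₂) {u v : ℤ}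
    (h : u * p₁ + v * p₂ = 1) (h' : v * p₂ + u * p₁ = 1) :
    Disjoint (mixedReps p₂ p₁ v u h') (mixedReps p₁ p₂ u v h) := by
  rw [Set.disjoint_left]
  rintro g (rfl | ⟨μ, hμ, hμ', rfl⟩) (hg | ⟨μ', h1, h2, hg⟩)
  · have h1 := congrArg (fun g : SL(2, ℤ) => g 0 0) hg
    simp only [M0, Matrix.SpecialLinearGroup.coe_mk, Matrix.of_apply, Matrix.cons_val',
      Matrix.cons_val_zero, Matrix.cons_val_fin_one] at h1
    -- The equality `v p₂ = u p₁` is impossible by parity, since the two numbers sum to 1.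
    omega
  · have h1 := congrArg (fun g : SL(2, ℤ) => g 1 1) hg
    simp [M, M0] at h1
  · have h1 := congrArg (fun g : SL(2, ℤ) => g 1 1) hg
    simp [M, M0] at h1
  · have h3 := congrArg (fun g : SL(2, ℤ) => g 0 0) hg
    simp only [M, Matrix.SpecialLinearGroup.coe_mk, Matrix.of_apply, Matrix.cons_val',
      Matrix.cons_val_zero, Matrix.cons_val_fin_one] at h3
    have h4 : (p₁ : ℤ) ∣ μ * p₂ := ⟨μ', by rw [h3, mul_comm]⟩
    exact (dvd_or_dvd' h4).elim (not_dvd_natCast hμ hμ') (not_dvd_of_ne hne)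

theorem ncard_mixed {p₁ p₂ : ℕ} [Fact p₁.Prime] [Fact p₂.Prime] (hne : p₁ ≠ p₂)
    {u v : ℤ} (h : u * p₁ + v * p₂ = 1) (h' : v * p₂ + u * p₁ = 1) :
    (commonReps (p₁ * p₂) ∪ mixedReps p₂ p₁ v u h' ∪ mixedReps p₁ p₂ u v h).ncard =
      (p₁ * p₂ + 1) + (p₁ + p₂) := by
  have h₁ : p₁ ≠ 0 := (Fact.out : p₁.Prime).ne_zero
  have h₂ : p₂ ≠ 0 := (Fact.out : p₂.Prime).ne_zero
  obtain ⟨f₀, c₀⟩ := finite_ncard_commonReps (p₁ * p₂)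
  obtain ⟨f₁, c₁⟩ := finite_ncard_mixedReps h₂ h₁ h'
  obtain ⟨f₂, c₂⟩ := finite_ncard_mixedReps h₁ h₂ h
  rw [Set.ncard_union_eq (Set.disjoint_union_left.2
    ⟨disjoint_commonReps_mixedReps _ h₁ h, disjoint_mixedReps hne h h'⟩) (f₀.union f₁) f₂,
    Set.ncard_union_eq (disjoint_commonReps_mixedReps _ h₂ h') f₀ f₁, c₀, c₁, c₂, add_assoc]

theorem ncard_square {p : ℕ} (hp : p ≠ 0) :
    (commonReps (p * p) ∪ squareReps p).ncard = (p * p + 1) + (p - 1) := by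
  obtain ⟨f₀, c₀⟩ := finite_ncard_commonReps (p * p)
  obtain ⟨f₁, c₁⟩ := finite_ncard_squareReps hp p
  rw [squareReps, Set.ncard_union_eq (disjoint_commonReps_M _ hp) f₀ f₁, c₀, c₁]

/-! The functions are symmetric in the two primes. -/

lemma w_swap (p₁ p₂ : ℕ) (z : ℂ) : w p₂ p₁ z = w p₁ p₂ z := by
  rw [w, w, mul_comm (p₂ : ℂ), mul_comm (ModularForm.eta (z / p₂))]

lemma r_swap (p₁ p₂ : ℕ) : r p₂ p₁ = r p₁ p₂ := by
  rw [r, r, mul_comm ((p₂ : ℚ) - 1)]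

lemma IsConjugate.swap {p₁ p₂ : ℕ} {g : SL(2, ℤ)} {f : ℂ → ℂ} {o : ℚ} {l : ℂ}
    (h : IsConjugate p₂ p₁ g f o l) : IsConjugate p₁ p₂ g f o l :=
  ⟨fun z => by rw [← w_swap, h.1 z], h.2⟩

end DoubleEta

end

/-! ### Assembly; the family `C_{1,ν}` follows from `C_{2,ν}` by exchanging the primes. -/

theorem mainTheorem3 (p₁ p₂ : ℕ) [Fact p₁.Prime] [Fact p₂.Prime] :
    -- the conjugates of `𝔴 ^ s` are indexed by the cosets of `Γ⁰(p₁ p₂)`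
    (∀ g ∈ DoubleEta.GammaUpper0 (p₁ * p₂), ∀ z : UpperHalfPlane,
      DoubleEta.w p₁ p₂ ((g • z : UpperHalfPlane) : ℂ) ^ DoubleEta.s p₁ p₂ =
        DoubleEta.w p₁ p₂ (z : ℂ) ^ DoubleEta.s p₁ p₂) ∧
    -- the functions `A_ν`
    (∀ ν : ℕ, ν < p₁ * p₂ →
      DoubleEta.IsConjugate p₁ p₂ (ModularGroup.T ^ ν) (DoubleEta.A p₁ p₂ ν)
        (-DoubleEta.r p₁ p₂ / (p₁ * p₂))
        (DoubleEta.zetaPow (p₁ * p₂) (-(ν * DoubleEta.r p₁ p₂))) ∧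
      ∀ z : ℂ, 0 < z.im → DoubleEta.A p₁ p₂ ν z = DoubleEta.w p₁ p₂ (z + ν)) ∧
    -- the function `B`
    (DoubleEta.IsConjugate p₁ p₂ ModularGroup.S (DoubleEta.B p₁ p₂) (-DoubleEta.r p₁ p₂) 1 ∧
      ∀ z : ℂ, 0 < z.im → DoubleEta.B p₁ p₂ z = DoubleEta.w p₁ p₂ (p₁ * p₂ * z)) ∧
    -- the remaining `p₁ + p₂` conjugates when `p₁ ≠ p₂`
    (p₁ ≠ p₂ → ∀ (u v : ℤ) (h : u * p₁ + v * p₂ = 1) (h' : v * p₂ + u * p₁ = 1),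
      -- `C_{1,0}` and `C_{1,ν}`
      DoubleEta.IsConjugate p₁ p₂ (DoubleEta.M0 p₂ p₁ v u h')
        (DoubleEta.C p₂ p₁ (DoubleEta.theta0 p₁ v u) 0) (DoubleEta.r p₁ p₂ / p₁)
        (DoubleEta.factor p₂ p₁ (DoubleEta.theta0 p₁ v u)) ∧
      (∀ ν : ℕ, 1 ≤ ν → ν < p₁ → ∃! μ : ℕ, 1 ≤ μ ∧ μ < p₁ ∧ p₁ ∣ 1 + p₂ * μ * ν) ∧
      (∀ (μ ν : ℕ) (v₁ : ℤ), 1 ≤ μ → μ < p₁ → 1 ≤ ν → ν < p₁ → p₁ * v₁ = 1 + p₂ * μ * ν →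
        DoubleEta.IsConjugate p₁ p₂ (DoubleEta.M p₂ μ)
          (DoubleEta.C p₂ p₁ (DoubleEta.theta p₂ p₁ μ ν v₁) ν) (DoubleEta.r p₁ p₂ / p₁)
          (DoubleEta.factor p₂ p₁ (DoubleEta.theta p₂ p₁ μ ν v₁) *
            DoubleEta.zetaPow p₁ (ν * DoubleEta.r p₁ p₂))) ∧
      -- `C_{2,0}` and `C_{2,ν}`
      DoubleEta.IsConjugate p₁ p₂ (DoubleEta.M0 p₁ p₂ u v h)
        (DoubleEta.C p₁ p₂ (DoubleEta.theta0 p₂ u v) 0) (DoubleEta.r p₁ p₂ / p₂)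
        (DoubleEta.factor p₁ p₂ (DoubleEta.theta0 p₂ u v)) ∧
      (∀ ν : ℕ, 1 ≤ ν → ν < p₂ → ∃! μ : ℕ, 1 ≤ μ ∧ μ < p₂ ∧ p₂ ∣ 1 + p₁ * μ * ν) ∧
      (∀ (μ ν : ℕ) (v₂ : ℤ), 1 ≤ μ → μ < p₂ → 1 ≤ ν → ν < p₂ → p₂ * v₂ = 1 + p₁ * μ * ν →
        DoubleEta.IsConjugate p₁ p₂ (DoubleEta.M p₁ μ)
          (DoubleEta.C p₁ p₂ (DoubleEta.theta p₁ p₂ μ ν v₂) ν) (DoubleEta.r p₁ p₂ / p₂)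
          (DoubleEta.factor p₁ p₂ (DoubleEta.theta p₁ p₂ μ ν v₂) *
            DoubleEta.zetaPow p₂ (ν * DoubleEta.r p₁ p₂))) ∧
      -- the list is complete
      DoubleEta.IsCosetSystem (p₁ * p₂)
        (DoubleEta.commonReps (p₁ * p₂) ∪ DoubleEta.mixedReps p₂ p₁ v u h' ∪
          DoubleEta.mixedReps p₁ p₂ u v h) ∧
      (DoubleEta.commonReps (p₁ * p₂) ∪ DoubleEta.mixedReps p₂ p₁ v u h' ∪
          DoubleEta.mixedReps p₁ p₂ u v h).ncard = (p₁ * p₂ + 1) + (p₁ + p₂)) ∧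
    -- the remaining `p - 1` conjugates when `p₁ = p₂ = p`
    (p₁ = p₂ →
      (∀ ν : ℕ, 1 ≤ ν → ν < p₁ → ∃! μ : ℕ, 1 ≤ μ ∧ μ < p₁ ∧ p₁ ∣ 1 + μ * ν) ∧
      (∀ (μ ν : ℕ) (v : ℤ), 1 ≤ μ → μ < p₁ → 1 ≤ ν → ν < p₁ → 1 = -(μ * ν : ℤ) + v * p₁ →
        DoubleEta.IsConjugate p₁ p₂ (DoubleEta.M p₁ μ)
          (DoubleEta.CSq p₁ (DoubleEta.thetaSq p₁ μ ν v) ν) (((p₁ : ℚ) - 1) / 12)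
          ((Real.sqrt p₁ : ℂ) * (DoubleEta.epsSq p₁ ν : ℂ) *
            DoubleEta.zetaPow (24 * p₁) (p₁ * DoubleEta.thetaSq p₁ μ ν v - ν))) ∧
      -- the list is complete
      DoubleEta.IsCosetSystem (p₁ * p₂)
        (DoubleEta.commonReps (p₁ * p₂) ∪ DoubleEta.squareReps p₁) ∧
      (DoubleEta.commonReps (p₁ * p₂) ∪ DoubleEta.squareReps p₁).ncard =
        (p₁ * p₂ + 1) + (p₁ - 1)) := by
  have hp₁ : p₁ ≠ 0 := (Fact.out : p₁.Prime).ne_zero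
  have hp₂ : p₂ ≠ 0 := (Fact.out : p₂.Prime).ne_zero
  refine ⟨fun g hg z => DoubleEta.w_smul_pow (Nat.pos_of_ne_zero hp₁) (Nat.pos_of_ne_zero hp₂) hg z,
    fun ν _ => ⟨DoubleEta.isConjugate_A hp₁ hp₂ ν, fun z _ => DoubleEta.A_eq_w p₁ p₂ ν z⟩,
    ⟨DoubleEta.isConjugate_B hp₁ hp₂, fun z _ => DoubleEta.B_eq_w hp₁ hp₂ z⟩,
    fun hne u v h h' => ⟨?_, ?_, ?_, ?_, ?_, ?_, ?_, ?_⟩, ?_⟩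
  · rw [← DoubleEta.r_swap]
    exact (DoubleEta.isConjugate_C_zero hne.symm h').swap
  · exact fun ν hν hν' => DoubleEta.existsUnique_mu (DoubleEta.not_dvd_of_ne hne) hν hν'
  · intro μ ν v₁ hμ hμ' hν hν' hv
    rw [← DoubleEta.r_swap]
    exact (DoubleEta.isConjugate_C hne.symm hμ hμ' hν hν' hv).swap
  · exact DoubleEta.isConjugate_C_zero hne h
  · exact fun ν hν hν' => DoubleEta.existsUnique_mu (DoubleEta.not_dvd_of_ne hne.symm) hν hν'
  · exact fun μ ν v₂ hμ hμ' hν hν' hv => DoubleEta.isConjugate_C hne hμ hμ' hν hν' hv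
  · exact DoubleEta.isCosetSystem_mixed hne h h'
  · exact DoubleEta.ncard_mixed hne h h'
  · rintro rfl
    refine ⟨fun ν hν hν' => ?_, fun μ ν v hμ hμ' hν hν' hv =>
      DoubleEta.isConjugate_CSq hμ hμ' hν hν' hv, DoubleEta.isCosetSystem_square,
      DoubleEta.ncard_square hp₁⟩
    have h1 : ¬ (p₁ : ℤ) ∣ (1 : ℕ) := DoubleEta.not_dvd_natCast le_rfl (Fact.out : p₁.Prime).one_lt
    simpa using DoubleEta.existsUnique_mu h1 hν hν'
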